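/- For $A\in\mathbf M_n(\mathbb C)$ and $1\le k\le n$, the rank-$k$ numerical range $\Lambda_k(A)$ is the set of all $\lambda\in\mathbb C$ for which there is an orthogonal projection $P\in\mathbf M_n(\mathbb C)$ of rank $k$ with $PAP=\lambda P$. (i) Let $b,c\ge 0$ with $b^2+c^2=1$, and let $A\in\mathbf M_4(\mathbb C)$ be unitarily similar to $$\begin{bmatrix} 0&0&1&0\\ 0&0&0&b\\ 0&0&0&c\\ 0&0&0&0\end{bmatrix}.$$ Then $\Lambda_2(A)$ is the closed disk centered at the origin of radius $$r_2=\sqrt{\tfrac14-\sqrt{\tfrac1{16}-\tfrac{b^2}{16}}}$$ (a single point if $b=0$), and, if $b\neq 0$, $\Lambda_3(A)=\emptyset$. (ii) Let $b,c,s,t\ge 0$ with $s^2+t^2=b^2+c^2=1$ and $bcst=0$, and let $A\in\mathbf M_5(\mathbb C)$ be unitarily similar to $$\begin{bmatrix} 0&0&1&0&0\\ 0&0&0&b&tc\\ 0&0&0&c&-tb\\ 0&0&0&0&s\\ 0&0&0&0&0\end{bmatrix}.$$ Then $\Lambda_2(A)$ is the closed disk centered at the origin of radius $$r_-=\frac12\sqrt{\frac{3-\sqrt{5-4(b^2+c^2t^2)}}{2}},$$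 $\Lambda_3(A)=\{0\}$, and $\Lambda_4(A)=\emptyset$. -/

import Mathlib

/-- The rank-`k` numerical range of `A`: all `z` such that `P A P = z P` for some orthogonal
projection `P` (self-adjoint idempotent matrix) of rank `k`. -/
def rankNumericalRange {n : ℕ} (k : ℕ) (A : Matrix (Fin n) (Fin n) ℂ) : Set ℂ :=
  {z | ∃ P : Matrix (Fin n) (Fin n) ℂ, IsStarProjection P ∧ P.rank = k ∧ P * A * P = z • P}

/-- `A` is unitarily similar to `M`: `A = U⋆ M U` for some unitary matrix `U`. -/
def UnitarilySimilar {n : ℕ} (A M : Matrix (Fin n) (Fin n) ℂ) : Prop :=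
  ∃ U ∈ Matrix.unitaryGroup (Fin n) ℂ, A = star U * M * U

/-- The canonical form of a 4-by-4 nilpotent partial isometry of rank two. -/
def nilpotentFour (b c : ℝ) : Matrix (Fin 4) (Fin 4) ℂ :=
  !![0, 0, 1, 0;
     0, 0, 0, (b : ℂ);
     0, 0, 0, (c : ℂ);
     0, 0, 0, 0]

/-- The canonical form of a 5-by-5 nilpotent partial isometry of rank three. -/
def nilpotentFive (b c s t : ℝ) : Matrix (Fin 5) (Fin 5) ℂ :=
  !![0, 0, 1, 0, 0;
     0, 0, 0, (b : ℂ), (t : ℂ) * (c : ℂ);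
     0, 0, 0, (c : ℂ), -((t : ℂ) * (b : ℂ));
     0, 0, 0, 0, (s : ℂ);
     0, 0, 0, 0, 0]

open Matrix

/-! The canonical forms carry a grading that they raise by one, so they are unitarily similar to all
their unimodular multiples and every `rankNumericalRange` is invariant under rotation. Only the real
points `x ≥ 0` then have to be found.

Outer bound: if `P A P = x P`, the Hermitian matrix `A + Aᴴ` has Rayleigh quotient `2x` on the whole
`k`-dimensional range of `P`. That range contains a nonzero vector orthogonal to any fewer than `k`
eigenvectors, so `2x` is at most the `k`-th largest eigenvalue. The characteristic polynomials give
the eigenvalues `±a, ±d` (and `0` in size five) with `d ≤ a`, and `d / 2` is the asserted radius.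
The next eigenvalue is `-d` in size four, and `0`, `-d` follow in size five, which bounds the
higher-rank ranges.

Inner bound (`ofReal_mem_rankNumericalRange_two_of_diagonal`): for `0 ≤ 2x ≤ d` the symmetric part
of `A - x` is diagonal in the eigenvectors for `a, d, -d, -a`, with signs `+, +, -, -`. Graphs of
isometries from the positive to the negative plane are isotropic for it, and they include a circle
of planes. Vanishing of the skew part on such a plane is one affine equation on the circle, solvable
under a scalar inequality. `balance_four` and `balance_five` supply that inequality. The degenerate
parameters are handled by explicit vectors, and `b = 0` in size five by passing to the adjoint. -/

/-! ### Unitary invariance and circular symmetry. -/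

theorem mem_rankNumericalRange_of_unitary_conj {n k : ℕ} {A U : Matrix (Fin n) (Fin n) ℂ} {z : ℂ}
    (hU : U ∈ unitaryGroup (Fin n) ℂ) (hz : z ∈ rankNumericalRange k A) :
    z ∈ rankNumericalRange k (star U * A * U) := by
  obtain ⟨P, hP, hr, h⟩ := hz
  have h1 : star U * U = 1 := (Unitary.mem_iff.1 hU).1
  have h2 : U * star U = 1 := (Unitary.mem_iff.1 hU).2
  have hdet : IsUnit U.det := (isUnit_iff_isUnit_det U).1 ⟨⟨U, star U, h2, h1⟩, rfl⟩
  have hdet' : IsUnit (star U).det := (isUnit_iff_isUnit_det _).1 ⟨⟨star U, U, h1, h2⟩, rfl⟩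
  refine ⟨star U * P * U, ⟨?_, ?_⟩, ?_, ?_⟩
  · calc star U * P * U * (star U * P * U) = star U * P * (U * star U) * P * U := by noncomm_ring
      _ = star U * (P * P) * U := by rw [h2]; noncomm_ring
      _ = star U * P * U := by rw [hP.isIdempotentElem.eq]
  · rw [IsSelfAdjoint, star_mul, star_mul, star_star, hP.isSelfAdjoint.star_eq, mul_assoc]
  · rw [rank_mul_eq_left_of_isUnit_det U _ hdet, rank_mul_eq_right_of_isUnit_det _ _ hdet', hr]
  · calc star U * P * U * (star U * A * U) * (star U * P * U)
        = star U * P * (U * star U) * A * (U * star U) * P * U := by noncomm_ring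
      _ = star U * (P * A * P) * U := by rw [h2]; noncomm_ring
      _ = z • (star U * P * U) := by rw [h]; simp

theorem UnitarilySimilar.rankNumericalRange_eq {n k : ℕ} {A M : Matrix (Fin n) (Fin n) ℂ}
    (h : UnitarilySimilar A M) : rankNumericalRange k A = rankNumericalRange k M := by
  obtain ⟨U, hU, rfl⟩ := h
  refine Set.Subset.antisymm (fun z hz => ?_)
    fun z hz => mem_rankNumericalRange_of_unitary_conj hU hz
  have h2 : U * star U = 1 := (Unitary.mem_iff.1 hU).2
  have := mem_rankNumericalRange_of_unitary_conj (Unitary.star_mem hU) hz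
  rwa [star_star, show U * (star U * M * U) * star U = (U * star U) * M * (U * star U) by
    noncomm_ring, h2, one_mul, mul_one] at this

theorem smul_mem_rankNumericalRange_smul {n k : ℕ} {A : Matrix (Fin n) (Fin n) ℂ} {z : ℂ} (w : ℂ)
    (hz : z ∈ rankNumericalRange k A) : w * z ∈ rankNumericalRange k (w • A) := by
  obtain ⟨P, hP, hr, h⟩ := hz
  exact ⟨P, hP, hr, by rw [mul_smul_comm, smul_mul_assoc, h, smul_smul]⟩

theorem star_mem_rankNumericalRange_conjTranspose {n k : ℕ} {A : Matrix (Fin n) (Fin n) ℂ} {z : ℂ}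
    (hz : z ∈ rankNumericalRange k A) : star z ∈ rankNumericalRange k Aᴴ := by
  obtain ⟨P, hP, hr, h⟩ := hz
  have hP' : Pᴴ = P := hP.isSelfAdjoint
  refine ⟨P, hP, hr, ?_⟩
  have := congrArg conjTranspose h
  rw [conjTranspose_mul, conjTranspose_mul, hP', conjTranspose_smul, hP'] at this
  rwa [mul_assoc]

/-- A matrix is graded by `d` if its nonzero entries raise the degree by one. -/
def IsGradedBy {n : ℕ} (M : Matrix (Fin n) (Fin n) ℂ) (d : Fin n → ℕ) : Prop :=
  ∀ i j, M i j ≠ 0 → d j = d i + 1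

/-- Conjugation by the diagonal matrix of the `w ^ d i` multiplies the entry at `(i, j)` by `w` to
the power `d j - d i`, which is `w` wherever the entry is nonzero. -/
theorem IsGradedBy.unitarilySimilar_smul {n : ℕ} {M : Matrix (Fin n) (Fin n) ℂ} {d : Fin n → ℕ}
    (h : IsGradedBy M d) {w : ℂ} (hw : star w * w = 1) : UnitarilySimilar (w • M) M := by
  refine ⟨diagonal fun i => w ^ d i, ?_, ?_⟩
  · rw [mem_unitaryGroup_iff', star_eq_conjTranspose, diagonal_conjTranspose, diagonal_mul_diagonal]
    rw [← diagonal_one]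
    congr 1
    funext i
    simp only [Pi.star_apply, star_pow, ← mul_pow, hw, one_pow]
  · ext i j
    rw [star_eq_conjTranspose, diagonal_conjTranspose, mul_diagonal, diagonal_mul]
    simp only [Matrix.smul_apply, smul_eq_mul, Pi.star_apply, star_pow]
    by_cases hij : M i j = 0
    · simp [hij]
    · rw [h i j hij, pow_succ]
      calc w * M i j = (star w * w) ^ d i * w * M i j := by rw [hw]; ring
        _ = _ := by rw [mul_pow]; ring

theorem IsGradedBy.smul_mem {n k : ℕ} {M : Matrix (Fin n) (Fin n) ℂ} {d : Fin n → ℕ}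
    (h : IsGradedBy M d) {w z : ℂ} (hw : star w * w = 1) (hz : z ∈ rankNumericalRange k M) :
    w * z ∈ rankNumericalRange k M := by
  rw [← (h.unitarilySimilar_smul hw).rankNumericalRange_eq]
  exact smul_mem_rankNumericalRange_smul w hz

theorem IsGradedBy.norm_mem_iff {n k : ℕ} {M : Matrix (Fin n) (Fin n) ℂ} {d : Fin n → ℕ}
    (h : IsGradedBy M d) (z : ℂ) :
    ((‖z‖ : ℝ) : ℂ) ∈ rankNumericalRange k M ↔ z ∈ rankNumericalRange k M := by
  have hw : star (Complex.exp (z.arg * Complex.I)) * Complex.exp (z.arg * Complex.I) = 1 := by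
    rw [Complex.star_def, ← Complex.normSq_eq_conj_mul_self, Complex.normSq_eq_norm_sq,
      Complex.norm_exp_ofReal_mul_I]
    simp
  have hz : Complex.exp (z.arg * Complex.I) * (‖z‖ : ℝ) = z := by
    rw [mul_comm]; exact Complex.norm_mul_exp_arg_mul_I z
  constructor
  · intro hm
    have := h.smul_mem hw hm
    rwa [hz] at this
  · intro hm
    have := h.smul_mem (w := star (Complex.exp (z.arg * Complex.I)))
      (by rw [star_star, mul_comm, hw]) hm
    have hz' : star (Complex.exp (z.arg * Complex.I)) * z = (‖z‖ : ℝ) := by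
      rw [← one_mul ((‖z‖ : ℝ) : ℂ), ← hw, mul_assoc, hz]
    rwa [hz'] at this

theorem IsGradedBy.rankNumericalRange_eq_closedBall {n k : ℕ} {M : Matrix (Fin n) (Fin n) ℂ}
    {d : Fin n → ℕ} (h : IsGradedBy M d) {r : ℝ}
    (hle : ∀ x : ℝ, (x : ℂ) ∈ rankNumericalRange k M → x ≤ r)
    (hmem : ∀ x : ℝ, 0 ≤ x → x ≤ r → (x : ℂ) ∈ rankNumericalRange k M) :
    rankNumericalRange k M = Metric.closedBall 0 r := by
  ext z
  rw [mem_closedBall_zero_iff, ← h.norm_mem_iff]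
  exact ⟨hle _, hmem _ (norm_nonneg z)⟩

theorem IsGradedBy.rankNumericalRange_eq_empty {n k : ℕ} {M : Matrix (Fin n) (Fin n) ℂ}
    {d : Fin n → ℕ} (h : IsGradedBy M d)
    (hlt : ∀ x : ℝ, (x : ℂ) ∈ rankNumericalRange k M → x < 0) :
    rankNumericalRange k M = ∅ := by
  refine Set.eq_empty_of_forall_notMem fun z hz => ?_
  exact (hlt _ ((h.norm_mem_iff z).2 hz)).not_ge (norm_nonneg z)

/-! ### Membership from spanning vectors, and the eigenvalue bound. -/

/-- If the columns of `V` span a `k`-dimensional subspace on which the sesquilinear form of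
`A - z` vanishes, then `z` lies in the rank-`k` numerical range. -/
theorem mem_rankNumericalRange_of_gram {n k : ℕ} {A : Matrix (Fin n) (Fin n) ℂ} {z : ℂ}
    (V : Matrix (Fin n) (Fin k) ℂ) (hV : IsUnit (Vᴴ * V).det)
    (h : Vᴴ * A * V = z • (Vᴴ * V)) : z ∈ rankNumericalRange k A := by
  set G := Vᴴ * V with hG
  have hGG : G⁻¹ * G = 1 := nonsing_inv_mul G hV
  have hGH : G⁻¹ᴴ = G⁻¹ := by
    rw [conjTranspose_nonsing_inv, hG, conjTranspose_mul, conjTranspose_conjTranspose]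
  -- This is the orthogonal projection onto the column space of `V`; no orthonormalization is
  -- needed.
  refine ⟨V * G⁻¹ * Vᴴ, ⟨?_, ?_⟩, ?_, ?_⟩
  · show V * G⁻¹ * Vᴴ * (V * G⁻¹ * Vᴴ) = _
    calc V * G⁻¹ * Vᴴ * (V * G⁻¹ * Vᴴ) = V * (G⁻¹ * (Vᴴ * V)) * G⁻¹ * Vᴴ := by
          simp only [Matrix.mul_assoc]
      _ = _ := by rw [← hG, hGG, Matrix.mul_one]
  · rw [IsSelfAdjoint, star_eq_conjTranspose, conjTranspose_mul, conjTranspose_mul, hGH,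
      conjTranspose_conjTranspose, Matrix.mul_assoc]
  · apply le_antisymm
    · exact (rank_mul_le_right _ _).trans ((rank_le_card_height _).trans (by simp))
    · have h1 : Vᴴ * (V * G⁻¹ * Vᴴ) * V = G := by
        calc Vᴴ * (V * G⁻¹ * Vᴴ) * V = G * (G⁻¹ * G) := by
              simp only [hG, Matrix.mul_assoc]
          _ = G := by rw [hGG, Matrix.mul_one]
      have h2 : G.rank = k := by
        rw [rank_of_isUnit G ((isUnit_iff_isUnit_det G).2 hV), Fintype.card_fin]
      calc k = (Vᴴ * (V * G⁻¹ * Vᴴ) * V).rank := by rw [h1, h2]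
        _ ≤ (Vᴴ * (V * G⁻¹ * Vᴴ)).rank := rank_mul_le_left _ _
        _ ≤ (V * G⁻¹ * Vᴴ).rank := rank_mul_le_right _ _
  · calc V * G⁻¹ * Vᴴ * A * (V * G⁻¹ * Vᴴ) = V * G⁻¹ * (Vᴴ * A * V) * G⁻¹ * Vᴴ := by
          simp only [Matrix.mul_assoc]
      _ = z • (V * (G⁻¹ * G) * G⁻¹ * Vᴴ) := by
          rw [h]; simp only [Matrix.mul_assoc, Matrix.mul_smul, Matrix.smul_mul]
      _ = _ := by rw [hGG, Matrix.mul_one]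

/-- If `A + Aᴴ` has fewer than `k` eigenvalues above `r`, then the real points of the rank-`k`
numerical range are at most `r / 2`. -/
theorem two_mul_le_of_ofReal_mem_rankNumericalRange {n k : ℕ} {A : Matrix (Fin n) (Fin n) ℂ}
    (hH : (A + Aᴴ).IsHermitian) {r x : ℝ}
    (hcard : Fintype.card {i // r < hH.eigenvalues i} < k)
    (hx : (x : ℂ) ∈ rankNumericalRange k A) : 2 * x ≤ r := by
  obtain ⟨P, hP, hr, h⟩ := hx
  set U : Matrix (Fin n) (Fin n) ℂ := (hH.eigenvectorUnitary : Matrix (Fin n) (Fin n) ℂ) with hU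
  have hUU : U * Uᴴ = 1 := (Unitary.mem_iff.1 hH.eigenvectorUnitary.2).2
  -- `L` takes the eigenbasis coordinates belonging to eigenvalues above `r`. There are fewer than
  -- `k` of them, so some nonzero `w` in the range of `P` has none.
  let L : (LinearMap.range P.mulVecLin) →ₗ[ℂ] ({i // r < hH.eigenvalues i} → ℂ) :=
    (LinearMap.funLeft ℂ ℂ (Subtype.val : {i // r < hH.eigenvalues i} → Fin n)) ∘ₗ
      Uᴴ.mulVecLin ∘ₗ (LinearMap.range P.mulVecLin).subtype
  have hker : LinearMap.ker L ≠ ⊥ := by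
    apply LinearMap.ker_ne_bot_of_finrank_lt
    rw [Module.finrank_fintype_fun_eq_card]
    rw [Matrix.rank] at hr
    omega
  obtain ⟨⟨w, hw⟩, hwL, hw0⟩ := (Submodule.ne_bot_iff _).1 hker
  have hw0' : w ≠ 0 := fun h => hw0 (Subtype.ext h)
  set y : Fin n → ℂ := Uᴴ *ᵥ w with hy
  have hy0 : ∀ i, r < hH.eigenvalues i → y i = 0 := fun i hi =>
    congrFun (show L ⟨w, hw⟩ = 0 from hwL) ⟨i, hi⟩
  have hwy : w = U *ᵥ y := by rw [hy, mulVec_mulVec, hUU, one_mulVec]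
  have hPw : P *ᵥ w = w := by
    obtain ⟨u, rfl⟩ := hw
    rw [mulVecLin_apply, mulVec_mulVec, hP.isIdempotentElem.eq]
  have hPH : Pᴴ = P := hP.isSelfAdjoint
  have hUy : star y ⬝ᵥ y = star w ⬝ᵥ w := by
    rw [hy, star_mulVec, conjTranspose_conjTranspose, ← dotProduct_mulVec, mulVec_mulVec, hUU,
      one_mulVec]
  have e1 : star w ⬝ᵥ ((A + Aᴴ) *ᵥ w) = 2 * x * (star w ⬝ᵥ w) := by
    have h' : P * (A + Aᴴ) * P = (2 * x : ℂ) • P := by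
      have := congrArg conjTranspose h
      rw [conjTranspose_mul, conjTranspose_mul, hPH, conjTranspose_smul, hPH, ← mul_assoc] at this
      rw [mul_add, add_mul, h, this, ← add_smul]
      simp [two_mul]
    have hq : star w ᵥ* P = star w := by
      conv_lhs => rw [← hPH]
      rw [← star_mulVec, hPw]
    calc star w ⬝ᵥ ((A + Aᴴ) *ᵥ w) = (star w ᵥ* P) ⬝ᵥ ((A + Aᴴ) *ᵥ (P *ᵥ w)) := by rw [hq, hPw]
      _ = star w ⬝ᵥ ((P * (A + Aᴴ) * P) *ᵥ w) := by
          rw [← dotProduct_mulVec, mulVec_mulVec, mulVec_mulVec, mul_assoc]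
      _ = _ := by rw [h', smul_mulVec, hPw, dotProduct_smul, smul_eq_mul]
  have e2 : star w ⬝ᵥ ((A + Aᴴ) *ᵥ w) = ∑ i, (hH.eigenvalues i : ℂ) * (star (y i) * y i) := by
    have hs := hH.spectral_theorem
    rw [Unitary.conjStarAlgAut_apply] at hs
    refine (congrArg (fun B => star w ⬝ᵥ (B *ᵥ w)) hs).trans ?_
    change star w ⬝ᵥ ((U * diagonal (RCLike.ofReal ∘ hH.eigenvalues) * Uᴴ) *ᵥ w) = _
    rw [← mulVec_mulVec, ← hy, ← mulVec_mulVec, dotProduct_mulVec]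
    have : star w ᵥ* U = star y := by rw [hy, star_mulVec, conjTranspose_conjTranspose]
    rw [this]
    simp only [dotProduct, mulVec_diagonal, Pi.star_apply, Function.comp]
    exact Finset.sum_congr rfl fun i _ => by simp; ring
  have e3 : ∑ i, hH.eigenvalues i * ‖y i‖ ^ 2 = 2 * x * ∑ i, ‖y i‖ ^ 2 := by
    have hn : ∀ i, star (y i) * y i = ((‖y i‖ ^ 2 : ℝ) : ℂ) := fun i => by
      rw [Complex.star_def, Complex.conj_mul']; push_cast; rfl
    rw [e2, ← hUy] at e1
    simp only [dotProduct, Pi.star_apply, hn] at e1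
    exact_mod_cast e1
  have hpos : 0 < ∑ i, ‖y i‖ ^ 2 := by
    have hy' : y ≠ 0 := fun h0 => hw0' (by rw [hwy, h0, mulVec_zero])
    obtain ⟨i, hi⟩ := Function.ne_iff.1 hy'
    exact Finset.sum_pos' (fun _ _ => by positivity) ⟨i, Finset.mem_univ i, by
      have := norm_pos_iff.2 hi; positivity⟩
  have hle : ∑ i, hH.eigenvalues i * ‖y i‖ ^ 2 ≤ r * ∑ i, ‖y i‖ ^ 2 := by
    rw [Finset.mul_sum]
    refine Finset.sum_le_sum fun i _ => ?_
    rcases le_or_gt (hH.eigenvalues i) r with hi | hi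
    · gcongr
    · simp [hy0 i hi]
  rw [e3] at hle
  exact le_of_mul_le_mul_right hle hpos

/-- The number of eigenvalues above `r`, read off from the characteristic polynomial. -/
theorem card_lt_eigenvalues_eq_countP {n : ℕ} {H : Matrix (Fin n) (Fin n) ℂ} (hH : H.IsHermitian)
    (s : Multiset ℝ)
    (hs : H.charpoly = (s.map fun a : ℝ => Polynomial.X - Polynomial.C (a : ℂ)).prod)
    (r : ℝ) : Fintype.card {i // r < hH.eigenvalues i} = s.countP (r < ·) := by
  have h1 : H.charpoly.roots = s.map (fun a : ℝ => (a : ℂ)) := by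
    rw [hs, ← Polynomial.roots_multiset_prod_X_sub_C (s.map fun a : ℝ => (a : ℂ)),
      Multiset.map_map]
    rfl
  rw [hH.roots_charpoly_eq_eigenvalues, ← Multiset.map_map] at h1
  have h2 := Multiset.map_injective Complex.ofReal_injective h1
  rw [← h2, Multiset.countP_map, Fintype.card_subtype]
  rfl

/-! ### Characteristic polynomials of `A + Aᴴ` and their roots. -/

theorem isHermitian_add_conjTranspose {n : ℕ} (A : Matrix (Fin n) (Fin n) ℂ) :
    (A + Aᴴ).IsHermitian := isHermitian_add_transpose_self A

theorem charpoly_nilpotentFour (b c : ℝ) (h : b ^ 2 + c ^ 2 = 1) :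
    (nilpotentFour b c + (nilpotentFour b c)ᴴ).charpoly =
      Polynomial.X ^ 4 - Polynomial.C 2 * Polynomial.X ^ 2 + Polynomial.C ((b : ℂ) ^ 2) := by
  have h' : (Polynomial.C (b : ℂ)) ^ 2 + Polynomial.C (c : ℂ) ^ 2 = 1 := by
    rw [← map_pow, ← map_pow, ← map_add, ← map_one Polynomial.C]; congr 1; exact_mod_cast h
  have e : (nilpotentFour b c + (nilpotentFour b c)ᴴ).charmatrix =
      !![Polynomial.X, 0, -1, 0;
         0, Polynomial.X, 0, -Polynomial.C (b : ℂ);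
         -1, 0, Polynomial.X, -Polynomial.C (c : ℂ);
         0, -Polynomial.C (b : ℂ), -Polynomial.C (c : ℂ), Polynomial.X] := by
    ext1 i j
    fin_cases i <;> fin_cases j <;> simp [nilpotentFour, conjTranspose_apply]
  rw [charpoly, e]
  simp [det_succ_row_zero, Fin.sum_univ_succ, Fin.succAbove, -map_neg]
  have h2 : (Polynomial.C 2 : Polynomial ℂ) = 2 := map_ofNat _ 2
  linear_combination (-Polynomial.X ^ 2) * h' + Polynomial.X ^ 2 * h2

/-- The constant term of the determinant is a multiple of `b * c * s * t`. Its vanishing makes the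
polynomial odd, so the spectrum is symmetric about `0`. -/
theorem charpoly_nilpotentFive (b c s t : ℝ) (h : b ^ 2 + c ^ 2 = 1) (h2 : s ^ 2 + t ^ 2 = 1)
    (h0 : b * c * s * t = 0) :
    (nilpotentFive b c s t + (nilpotentFive b c s t)ᴴ).charpoly =
      Polynomial.X ^ 5 - Polynomial.C 3 * Polynomial.X ^ 3 +
        Polynomial.C ((1 + b ^ 2 + c ^ 2 * t ^ 2 : ℝ) : ℂ) * Polynomial.X := by
  have e : (nilpotentFive b c s t + (nilpotentFive b c s t)ᴴ).charmatrix =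
      !![Polynomial.X, 0, -1, 0, 0;
         0, Polynomial.X, 0, -Polynomial.C (b : ℂ), -(Polynomial.C (t : ℂ) * Polynomial.C (c : ℂ));
         -1, 0, Polynomial.X, -Polynomial.C (c : ℂ), Polynomial.C (t : ℂ) * Polynomial.C (b : ℂ);
         0, -Polynomial.C (b : ℂ), -Polynomial.C (c : ℂ), Polynomial.X, -Polynomial.C (s : ℂ);
         0, -(Polynomial.C (t : ℂ) * Polynomial.C (c : ℂ)),
          Polynomial.C (t : ℂ) * Polynomial.C (b : ℂ), -Polynomial.C (s : ℂ), Polynomial.X] := by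
    ext1 i j
    fin_cases i <;> fin_cases j <;> simp [nilpotentFive, conjTranspose_apply]
  have hC : ∀ p : ℝ, Polynomial.C (((p : ℝ) : ℂ)) = (Polynomial.C.comp Complex.ofRealHom) p :=
    fun p => rfl
  rw [charpoly, e]
  simp only [hC]
  simp [det_succ_row_zero, Fin.sum_univ_succ, Fin.succAbove, -map_neg]
  have h' : (Polynomial.C (b : ℂ)) ^ 2 + Polynomial.C (c : ℂ) ^ 2 = 1 := by
    rw [← map_pow, ← map_pow, ← map_add, ← map_one Polynomial.C]; congr 1; exact_mod_cast h
  have h2' : (Polynomial.C (s : ℂ)) ^ 2 + Polynomial.C (t : ℂ) ^ 2 = 1 := by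
    rw [← map_pow, ← map_pow, ← map_add, ← map_one Polynomial.C]; congr 1; exact_mod_cast h2
  have h0' : Polynomial.C (b : ℂ) * Polynomial.C (c : ℂ) * Polynomial.C (s : ℂ) *
      Polynomial.C (t : ℂ) = 0 := by
    rw [← map_mul, ← map_mul, ← map_mul, ← map_zero Polynomial.C]; congr 1; exact_mod_cast h0
  have h3 : (Polynomial.C 3 : Polynomial ℂ) = 3 := map_ofNat _ 3
  generalize Polynomial.C (b : ℂ) = b' at *
  generalize Polynomial.C (c : ℂ) = c' at *
  generalize Polynomial.C (s : ℂ) = s' at *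
  generalize Polynomial.C (t : ℂ) = t' at *
  linear_combination (-Polynomial.X ^ 3 * (1 + t' ^ 2) + Polynomial.X * t' ^ 2 *
    (b' ^ 2 + c' ^ 2 + 1)) * h' + (-Polynomial.X ^ 3 + Polynomial.X) * h2' + 2 * h0' +
    Polynomial.X ^ 3 * h3

theorem prod_X_sub_C_four {a d b : ℝ} (h1 : a ^ 2 + d ^ 2 = 2) (h2 : a ^ 2 * d ^ 2 = b ^ 2) :
    (Polynomial.X ^ 4 - Polynomial.C 2 * Polynomial.X ^ 2 + Polynomial.C ((b : ℂ) ^ 2) :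
      Polynomial ℂ) = ((({a, d, -d, -a} : Multiset ℝ)).map
        fun a : ℝ => Polynomial.X - Polynomial.C (a : ℂ)).prod := by
  have e1 : (Polynomial.C (a : ℂ)) ^ 2 + Polynomial.C (d : ℂ) ^ 2 = Polynomial.C 2 := by
    rw [← map_pow, ← map_pow, ← map_add]; congr 1; exact_mod_cast h1
  have e2 : (Polynomial.C (a : ℂ)) ^ 2 * Polynomial.C (d : ℂ) ^ 2 =
      Polynomial.C ((b : ℂ) ^ 2) := by
    rw [← map_pow, ← map_pow, ← map_mul]; congr 1; exact_mod_cast h2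
  simp only [Multiset.insert_eq_cons, Multiset.map_cons, Multiset.map_singleton,
    Multiset.prod_cons, Multiset.prod_singleton, Complex.ofReal_neg, map_neg]
  rw [← e1, ← e2]
  ring

theorem prod_X_sub_C_five {a d e : ℝ} (h1 : a ^ 2 + d ^ 2 = 3) (h2 : a ^ 2 * d ^ 2 = e) :
    (Polynomial.X ^ 5 - Polynomial.C 3 * Polynomial.X ^ 3 + Polynomial.C (e : ℂ) * Polynomial.X :
      Polynomial ℂ) = ((({a, d, 0, -d, -a} : Multiset ℝ)).map
        fun a : ℝ => Polynomial.X - Polynomial.C (a : ℂ)).prod := by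
  have e1 : (Polynomial.C (a : ℂ)) ^ 2 + Polynomial.C (d : ℂ) ^ 2 = Polynomial.C 3 := by
    rw [← map_pow, ← map_pow, ← map_add]; congr 1; exact_mod_cast h1
  have e2 : (Polynomial.C (a : ℂ)) ^ 2 * Polynomial.C (d : ℂ) ^ 2 = Polynomial.C (e : ℂ) := by
    rw [← map_pow, ← map_pow, ← map_mul]; congr 1; exact_mod_cast h2
  simp only [Multiset.insert_eq_cons, Multiset.map_cons, Multiset.map_singleton,
    Multiset.prod_cons, Multiset.prod_singleton, Complex.ofReal_neg, Complex.ofReal_zero, map_neg,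
    map_zero]
  rw [← e1, ← e2]
  ring

theorem nilpotentFour_two_mul_le {k : ℕ} {a b c d r x : ℝ} (h : b ^ 2 + c ^ 2 = 1)
    (h1 : a ^ 2 + d ^ 2 = 2) (h2 : a ^ 2 * d ^ 2 = b ^ 2)
    (hr : ({a, d, -d, -a} : Multiset ℝ).countP (r < ·) < k)
    (hx : (x : ℂ) ∈ rankNumericalRange k (nilpotentFour b c)) : 2 * x ≤ r := by
  refine two_mul_le_of_ofReal_mem_rankNumericalRange (isHermitian_add_conjTranspose _) ?_ hx
  rwa [card_lt_eigenvalues_eq_countP _ _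
    ((charpoly_nilpotentFour b c h).trans (prod_X_sub_C_four h1 h2))]

theorem nilpotentFive_two_mul_le {k : ℕ} {a b c s t d r x : ℝ} (h : b ^ 2 + c ^ 2 = 1)
    (h' : s ^ 2 + t ^ 2 = 1) (h0 : b * c * s * t = 0)
    (h1 : a ^ 2 + d ^ 2 = 3) (h2 : a ^ 2 * d ^ 2 = 1 + b ^ 2 + c ^ 2 * t ^ 2)
    (hr : ({a, d, 0, -d, -a} : Multiset ℝ).countP (r < ·) < k)
    (hx : (x : ℂ) ∈ rankNumericalRange k (nilpotentFive b c s t)) : 2 * x ≤ r := by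
  refine two_mul_le_of_ofReal_mem_rankNumericalRange (isHermitian_add_conjTranspose _) ?_ hx
  rwa [card_lt_eigenvalues_eq_countP _ _
    ((charpoly_nilpotentFive b c s t h h' h0).trans (prod_X_sub_C_five h1 h2))]

/-! ### Isotropic pairs of real vectors. -/

/-- A line meets the unit circle when its distance `|a| / √(b ^ 2 + c ^ 2)` from the origin is at
most one. -/
theorem exists_sq_add_sq_eq_one_of_sq_le {a b c : ℝ} (h : a ^ 2 ≤ b ^ 2 + c ^ 2) :
    ∃ p q : ℝ, p ^ 2 + q ^ 2 = 1 ∧ a + p * b + q * c = 0 := by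
  rcases eq_or_ne (b ^ 2 + c ^ 2) 0 with h0 | h0
  · have hb : b = 0 := by nlinarith [sq_nonneg b, sq_nonneg c]
    have hc : c = 0 := by nlinarith [sq_nonneg b, sq_nonneg c]
    have ha : a = 0 := by nlinarith [sq_nonneg a]
    exact ⟨1, 0, by norm_num, by simp [ha, hb]⟩
  · have hd := Real.sq_sqrt (sub_nonneg.2 h)
    set d := Real.sqrt (b ^ 2 + c ^ 2 - a ^ 2)
    refine ⟨(-a * b - d * c) / (b ^ 2 + c ^ 2), (-a * c + d * b) / (b ^ 2 + c ^ 2), ?_, ?_⟩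
    · field_simp
      linear_combination (b ^ 2 + c ^ 2) * hd
    · field_simp
      ring

/-- A real isotropic pair of independent vectors for `M - x` puts `x` into the rank-two
numerical range. -/
theorem ofReal_mem_rankNumericalRange_two {n : ℕ} (M : Matrix (Fin n) (Fin n) ℝ) (x : ℝ)
    (v w : Fin n → ℝ) (hvw : (v ⬝ᵥ v) * (w ⬝ᵥ w) - (v ⬝ᵥ w) ^ 2 ≠ 0)
    (hvv : v ⬝ᵥ M *ᵥ v = x * (v ⬝ᵥ v)) (hww : w ⬝ᵥ M *ᵥ w = x * (w ⬝ᵥ w))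
    (h1 : v ⬝ᵥ M *ᵥ w = x * (v ⬝ᵥ w)) (h2 : w ⬝ᵥ M *ᵥ v = x * (v ⬝ᵥ w)) :
    (x : ℂ) ∈ rankNumericalRange 2 (M.map (algebraMap ℝ ℂ)) := by
  let V : Matrix (Fin n) (Fin 2) ℝ := (Matrix.of ![v, w])ᵀ
  have hVt : (V.map (algebraMap ℝ ℂ))ᴴ = (Vᵀ).map (algebraMap ℝ ℂ) := by
    ext i j; simp
  have hG : Vᵀ * V = !![v ⬝ᵥ v, v ⬝ᵥ w; v ⬝ᵥ w, w ⬝ᵥ w] := by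
    ext i j
    fin_cases i <;> fin_cases j <;> simp [V, Matrix.mul_apply, dotProduct, mul_comm]
  have hM : Vᵀ * M * V = !![v ⬝ᵥ M *ᵥ v, v ⬝ᵥ M *ᵥ w; w ⬝ᵥ M *ᵥ v, w ⬝ᵥ M *ᵥ w] := by
    ext i j
    fin_cases i <;> fin_cases j <;> rw [Matrix.mul_assoc] <;>
      simp [V, Matrix.mul_apply, dotProduct, mulVec]
  refine mem_rankNumericalRange_of_gram (V.map (algebraMap ℝ ℂ)) ?_ ?_
  · rw [hVt, ← Matrix.map_mul, isUnit_iff_ne_zero, hG]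
    rw [← RingHom.mapMatrix_apply, ← RingHom.map_det]
    simp only [det_fin_two_of, ne_eq, map_eq_zero]
    rwa [← pow_two]
  · rw [hVt, ← Matrix.map_mul, ← Matrix.map_mul, ← Matrix.map_mul, hM, hG, hvv, hww, h1, h2]
    ext i j
    fin_cases i <;> fin_cases j <;> simp

/-- Four orthogonal real vectors that diagonalize the symmetric part of `M - x` with signature
`(2, 2)` contain an isotropic pair, provided the skew part is suitably balanced. -/
theorem ofReal_mem_rankNumericalRange_two_of_diagonal {n : ℕ} (M : Matrix (Fin n) (Fin n) ℝ)
    (x : ℝ) (U : Fin 4 → Fin n → ℝ) (s₁₂ s₁₃ s₁₄ s₂₃ s₂₄ s₃₄ g₁ g₂ g₃ g₄ : ℝ)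
    (hg₃ : g₃ ≠ 0) (hg₄ : g₄ ≠ 0)
    (orth : ∀ i j, i < j → U i ⬝ᵥ U j = 0) (hU : ∀ i, U i ≠ 0)
    (hM : (of fun i j => U i ⬝ᵥ M *ᵥ U j - x * (U i ⬝ᵥ U j)) =
      !![g₁ ^ 2, s₁₂, s₁₃, s₁₄; -s₁₂, g₂ ^ 2, s₂₃, s₂₄; -s₁₃, -s₂₃, -g₃ ^ 2, s₃₄;
        -s₁₄, -s₂₄, -s₃₄, -g₄ ^ 2])
    (h : (g₃ * g₄ * s₁₂ - g₁ * g₂ * s₃₄) ^ 2 ≤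
      (g₂ * g₄ * s₁₃ - g₁ * g₃ * s₂₄) ^ 2 + (g₂ * g₃ * s₁₄ + g₁ * g₄ * s₂₃) ^ 2) :
    (x : ℂ) ∈ rankNumericalRange 2 (M.map (algebraMap ℝ ℂ)) := by
  rw [← neg_sq (g₂ * g₃ * s₁₄ + g₁ * g₄ * s₂₃)] at h
  obtain ⟨p, q, hpq, h0⟩ := exists_sq_add_sq_eq_one_of_sq_le h
  have hm : ∀ i j, U i ⬝ᵥ M *ᵥ U j = (!![g₁ ^ 2, s₁₂, s₁₃, s₁₄; -s₁₂, g₂ ^ 2, s₂₃, s₂₄;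
      -s₁₃, -s₂₃, -g₃ ^ 2, s₃₄; -s₁₄, -s₂₄, -s₃₄, -g₄ ^ 2] : Matrix (Fin 4) (Fin 4) ℝ) i j +
      x * (U i ⬝ᵥ U j) := fun i j => by rw [← hM]; simp
  have o : ∀ i j, i < j → U j ⬝ᵥ U i = 0 := fun i j hij => by rw [dotProduct_comm, orth i j hij]
  have hp : ∀ i, 0 < U i ⬝ᵥ U i := fun i =>
    lt_of_le_of_ne (by simpa using dotProduct_star_self_nonneg (U i))
      fun h => hU i (dotProduct_self_eq_zero.1 h.symm)
  have h01 := orth 0 1 (by decide)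
  have h02 := orth 0 2 (by decide)
  have h03 := orth 0 3 (by decide)
  have h12 := orth 1 2 (by decide)
  have h13 := orth 1 3 (by decide)
  have h23 := orth 2 3 (by decide)
  have h10 := o 0 1 (by decide)
  have h20 := o 0 2 (by decide)
  have h30 := o 0 3 (by decide)
  have h21 := o 1 2 (by decide)
  have h31 := o 1 3 (by decide)
  have h32 := o 2 3 (by decide)
  have hp0 := hp 0
  have hp1 := hp 1
  have hp2 := hp 2
  have hp3 := hp 3
  -- Up to scaling, `U 0 / g₁` and `U 1 / g₂` are paired with orthonormal combinations of `U 2 / g₃`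
  -- and `U 3 / g₄`, so the symmetric part cancels for every `(p, q)` on the circle. `h0` then kills
  -- the skew part. Denominators are cleared because `g₁` and `g₂` may vanish.
  refine ofReal_mem_rankNumericalRange_two M x
    ((g₃ * g₄) • U 0 + (p * g₁ * g₃) • U 3 + (q * g₁ * g₄) • U 2)
    ((g₃ * g₄) • U 1 + (-q * g₂ * g₃) • U 3 + (p * g₂ * g₄) • U 2) ?_ ?_ ?_ ?_ ?_
  all_goals
    simp only [mulVec_add, mulVec_smul, dotProduct_add, add_dotProduct, dotProduct_smul,
      smul_dotProduct, hm, smul_eq_mul, h01, h02, h03, h12, h13, h23, h10, h20, h30, h21, h31, h32]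
    simp
  · refine ne_of_gt ?_
    set A := U 0 ⬝ᵥ U 0
    set B := U 1 ⬝ᵥ U 1
    set C := U 2 ⬝ᵥ U 2
    set D := U 3 ⬝ᵥ U 3
    have e : 0 < (g₃ * g₄) ^ 4 * (A * B) := by positivity
    have e1 : 0 ≤ (g₃ * g₄) ^ 2 * A * ((q * g₂ * g₃) ^ 2 * D + (p * g₂ * g₄) ^ 2 * C) := by
      positivity
    have e2 : 0 ≤ (g₃ * g₄) ^ 2 * B * ((p * g₁ * g₃) ^ 2 * D + (q * g₁ * g₄) ^ 2 * C) := by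
      positivity
    have e3 : 0 ≤ C * D * (p * g₁ * g₃ * (p * g₂ * g₄) + q * g₁ * g₄ * (q * g₂ * g₃)) ^ 2 := by
      positivity
    linarith
  · linear_combination (-(g₁ * g₃ * g₄) ^ 2) * hpq
  · linear_combination (-(g₂ * g₃ * g₄) ^ 2) * hpq
  · linear_combination (g₃ * g₄) * h0 - (g₁ * g₂ * g₃ * g₄ * s₃₄) * hpq
  · linear_combination -(g₃ * g₄) * h0 + (g₁ * g₂ * g₃ * g₄ * s₃₄) * hpq

/-! ### Real forms of the matrices and their eigenvectors. -/

theorem nilpotentFour_eq_map (b c : ℝ) : nilpotentFour b c =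
    (!![0, 0, 1, 0; 0, 0, 0, b; 0, 0, 0, c; 0, 0, 0, 0] : Matrix (Fin 4) (Fin 4) ℝ).map
      (algebraMap ℝ ℂ) := by
  ext i j
  fin_cases i <;> fin_cases j <;> simp [nilpotentFour]

theorem nilpotentFive_eq_map (b c s t : ℝ) : nilpotentFive b c s t =
    (!![0, 0, 1, 0, 0; 0, 0, 0, b, t * c; 0, 0, 0, c, -(t * b); 0, 0, 0, 0, s; 0, 0, 0, 0, 0] :
      Matrix (Fin 5) (Fin 5) ℝ).map (algebraMap ℝ ℂ) := by
  ext i j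
  fin_cases i <;> fin_cases j <;> simp [nilpotentFive]

/-- For `c ≠ 0` and `a / 2` an eigenvalue of the real part of `nilpotentFour b c`, an
eigenvector. -/
noncomputable def eigenvectorFour (b c a : ℝ) : Fin 4 → ℝ :=
  ![c, b * (a ^ 2 - 1) / a, c * a, a ^ 2 - 1]

/-- For `c ≠ 0` and `a / 2` a nonzero eigenvalue of the real part of `nilpotentFive b c 1 0`, an
eigenvector. -/
noncomputable def eigenvectorFive (b c a : ℝ) : Fin 5 → ℝ :=
  ![c, b * (a ^ 2 - 1) / a, c * a, a ^ 2 - 1, (a ^ 2 - 1) / a]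

theorem eigenvectorFour_dotProduct (b c a d : ℝ) :
    eigenvectorFour b c a ⬝ᵥ eigenvectorFour b c d =
      c ^ 2 + b ^ 2 * ((a ^ 2 - 1) * (d ^ 2 - 1)) / (a * d) + c ^ 2 * (a * d)
        + (a ^ 2 - 1) * (d ^ 2 - 1) := by
  simp [eigenvectorFour, Fin.sum_univ_succ, dotProduct]
  ring

theorem eigenvectorFour_form (b c a d : ℝ) :
    eigenvectorFour b c a ⬝ᵥ
        (!![0, 0, 1, 0; 0, 0, 0, b; 0, 0, 0, c; 0, 0, 0, 0] : Matrix (Fin 4) (Fin 4) ℝ) *ᵥ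
        eigenvectorFour b c d =
      c ^ 2 * d + b ^ 2 * ((a ^ 2 - 1) * (d ^ 2 - 1)) / a + c ^ 2 * a * (d ^ 2 - 1) := by
  simp [eigenvectorFour, Fin.sum_univ_succ, dotProduct, mulVec]
  ring

theorem eigenvectorFive_dotProduct (b c a d : ℝ) :
    eigenvectorFive b c a ⬝ᵥ eigenvectorFive b c d =
      c ^ 2 + (b ^ 2 + 1) * ((a ^ 2 - 1) * (d ^ 2 - 1)) / (a * d) + c ^ 2 * (a * d)
        + (a ^ 2 - 1) * (d ^ 2 - 1) := by
  simp [eigenvectorFive, Fin.sum_univ_succ, dotProduct]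
  ring

theorem eigenvectorFive_form (b c a d : ℝ) :
    eigenvectorFive b c a ⬝ᵥ
      (!![0, 0, 1, 0, 0; 0, 0, 0, b, 0 * c; 0, 0, 0, c, -(0 * b); 0, 0, 0, 0, 1; 0, 0, 0, 0, 0] :
      Matrix (Fin 5) (Fin 5) ℝ) *ᵥ eigenvectorFive b c d =
      c ^ 2 * d + b ^ 2 * ((a ^ 2 - 1) * (d ^ 2 - 1)) / a + c ^ 2 * a * (d ^ 2 - 1)
        + (a ^ 2 - 1) * (d ^ 2 - 1) / d := by
  simp [eigenvectorFive, Fin.sum_univ_succ, dotProduct, mulVec]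
  ring


/-! ### Scalar inequalities that balance the skew part. -/

theorem balance_five_aux {a d : ℝ} (ha : 0 < a) (hd : 0 < d) (hd1 : d ≤ 1) (h1 : a ^ 2 + d ^ 2 = 3)
    (h2 : 1 ≤ a * d) : 2 * (a - d) * (a * d + 1) ^ 2 * (1 - d ^ 2) * d ≤ a ^ 2 * (a ^ 2 - 1) := by
  have hp : a * d ≤ 3 / 2 := by nlinarith [sq_nonneg (a - d)]
  -- With `p = a * d`, `(a - d) ^ 2 = 3 - 2 * p` and `(2 - p) ^ 2` exceeds it by `(p - 1) ^ 2`. What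
  -- remains is a cubic in `p ≥ 1` and then a polynomial in `d` alone.
  have e1 : a - d ≤ 2 - a * d := by
    refine (abs_le_of_sq_le_sq' ?_ (by linarith)).2
    nlinarith [sq_nonneg (a * d - 1)]
  have e2 : 2 * (2 - a * d) * (a * d + 1) ^ 2 ≤ 8 := by
    nlinarith [mul_nonneg (sub_nonneg.2 h2) (mul_nonneg (sub_nonneg.2 h2) (sub_nonneg.2 h2)),
      sq_nonneg (a * d - 1)]
  have hd2 : 0 ≤ 1 - d ^ 2 := by nlinarith
  calc 2 * (a - d) * (a * d + 1) ^ 2 * (1 - d ^ 2) * d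
      ≤ 2 * (2 - a * d) * (a * d + 1) ^ 2 * (1 - d ^ 2) * d := by gcongr
    _ ≤ 8 * (1 - d ^ 2) * d := by gcongr
    _ ≤ a ^ 2 * (a ^ 2 - 1) := by
      rw [show a ^ 2 = 3 - d ^ 2 by linarith]
      nlinarith [sq_nonneg (d ^ 2 + 4 * d - 4), sq_nonneg (4 * d - 3), sq_nonneg (d - 3 / 4),
        mul_nonneg hd.le (sq_nonneg (4 * d - 3))]

theorem balance_four {a d y h₁ h₂ h₃ h₄ : ℝ} (hd : 0 < d) (hda : d ≤ a) (e₁ : h₁ ^ 2 = a - y)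
    (e₂ : h₂ ^ 2 = d - y) (e₃ : h₃ ^ 2 = d + y) (e₄ : h₄ ^ 2 = a + y) :
    ((a - d) * (h₃ * h₄ - h₁ * h₂)) ^ 2 ≤ ((a + d) * (h₂ * h₄ - h₁ * h₃)) ^ 2 := by
  have ha : 0 < a := hd.trans_le hda
  set D := h₁ * h₂ * h₃ * h₄ with hD
  have hD2 : D ^ 2 = (a ^ 2 - y ^ 2) * (d ^ 2 - y ^ 2) := by
    calc D ^ 2 = h₁ ^ 2 * h₂ ^ 2 * h₃ ^ 2 * h₄ ^ 2 := by rw [hD]; ring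
      _ = _ := by rw [e₁, e₂, e₃, e₄]; ring
  have k1 : (h₃ * h₄ - h₁ * h₂) ^ 2 = 2 * (a * d + y ^ 2 - D) := by
    calc _ = h₃ ^ 2 * h₄ ^ 2 + h₁ ^ 2 * h₂ ^ 2 - 2 * D := by rw [hD]; ring
      _ = _ := by rw [e₁, e₂, e₃, e₄]; ring
  have k2 : (h₂ * h₄ - h₁ * h₃) ^ 2 = 2 * (a * d - y ^ 2 - D) := by
    calc _ = h₂ ^ 2 * h₄ ^ 2 + h₁ ^ 2 * h₃ ^ 2 - 2 * D := by rw [hD]; ring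
      _ = _ := by rw [e₁, e₂, e₃, e₄]; ring
  have hle : D ≤ a * d - y ^ 2 := by
    refine (abs_le_of_sq_le_sq' ?_ (by nlinarith)).2
    rw [hD2]
    nlinarith [mul_nonneg (sq_nonneg y) (sq_nonneg (a - d))]
  rw [mul_pow, mul_pow, k1, k2]
  -- With `u = a * d - y ^ 2 - D ≥ 0`, the formula for `D ^ 2` turns half the difference of the two
  -- sides into `2 * u * (u + 2 * y ^ 2)`.
  nlinarith [mul_nonneg (sub_nonneg.2 hle) (add_nonneg (sub_nonneg.2 hle)
    (mul_nonneg zero_le_two (sq_nonneg y)))]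

/-! ### Real points of the rank-two range in size four, for `c > 0` and `d > 0`. -/

section four

variable {a b c d : ℝ}

/-- This is the relation between the two squared eigenvalues that drives the form computations. The
hypotheses are symmetric in `a, d` and blind to signs, so each lemma below serves all four
eigenvectors. -/
theorem sq_sub_one_mul_four (h : b ^ 2 + c ^ 2 = 1) (h1 : a ^ 2 + d ^ 2 = 2)
    (h2 : a ^ 2 * d ^ 2 = b ^ 2) : (a ^ 2 - 1) * (d ^ 2 - 1) = -c ^ 2 := by
  linear_combination h2 - h1 + h

/-- The real bilinear form of `nilpotentFour b c - x`. -/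
noncomputable def formFour (b c x : ℝ) (v w : Fin 4 → ℝ) : ℝ :=
  v ⬝ᵥ (!![0, 0, 1, 0; 0, 0, 0, b; 0, 0, 0, c; 0, 0, 0, 0] : Matrix (Fin 4) (Fin 4) ℝ) *ᵥ w -
    x * (v ⬝ᵥ w)

theorem eigenvectorFour_orthogonal (h : b ^ 2 + c ^ 2 = 1)
    (h1 : a ^ 2 + d ^ 2 = 2) (h2 : a ^ 2 * d ^ 2 = b ^ 2) :
    eigenvectorFour b c a ⬝ᵥ eigenvectorFour b c d = 0 := by
  rw [eigenvectorFour_dotProduct, sq_sub_one_mul_four h h1 h2, ← h2]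
  field_simp
  ring

theorem eigenvectorFour_orthogonal_neg (ha : a ≠ 0) (h : b ^ 2 + c ^ 2 = 1)
    (h1 : a ^ 2 + d ^ 2 = 2) (h2 : a ^ 2 * d ^ 2 = b ^ 2) :
    eigenvectorFour b c a ⬝ᵥ eigenvectorFour b c (-a) = 0 := by
  rw [eigenvectorFour_dotProduct, ← h2, neg_sq]
  field_simp
  have := sq_sub_one_mul_four h h1 h2
  rw [show d ^ 2 = 2 - a ^ 2 by linarith] at this ⊢
  linear_combination (1 - a ^ 2) * this

theorem formFour_eigenvectorFour (x : ℝ) (h : b ^ 2 + c ^ 2 = 1)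
    (h1 : a ^ 2 + d ^ 2 = 2) (h2 : a ^ 2 * d ^ 2 = b ^ 2) :
    formFour b c x (eigenvectorFour b c a) (eigenvectorFour b c d) = c ^ 2 * (d - a) := by
  rw [formFour, eigenvectorFour_orthogonal h h1 h2, eigenvectorFour_form,
    sq_sub_one_mul_four h h1 h2, ← h2]
  field_simp
  ring

theorem formFour_eigenvectorFour_neg (x : ℝ) (ha : a ≠ 0) (h : b ^ 2 + c ^ 2 = 1)
    (h1 : a ^ 2 + d ^ 2 = 2) (h2 : a ^ 2 * d ^ 2 = b ^ 2) :
    formFour b c x (eigenvectorFour b c a) (eigenvectorFour b c (-a)) = 0 := by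
  rw [formFour, eigenvectorFour_orthogonal_neg ha h h1 h2, eigenvectorFour_form, ← h2, neg_sq]
  field_simp
  have := sq_sub_one_mul_four h h1 h2
  rw [show d ^ 2 = 2 - a ^ 2 by linarith] at this ⊢
  linear_combination -a * (2 - a ^ 2) * this

theorem formFour_eigenvectorFour_self (x : ℝ) (ha : a ≠ 0) (h : b ^ 2 + c ^ 2 = 1)
    (h1 : a ^ 2 + d ^ 2 = 2) (h2 : a ^ 2 * d ^ 2 = b ^ 2) :
    formFour b c x (eigenvectorFour b c a) (eigenvectorFour b c a) =
      2 * c ^ 2 * (a - 2 * x) := by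
  rw [formFour, eigenvectorFour_form, eigenvectorFour_dotProduct, ← h2]
  field_simp
  have := sq_sub_one_mul_four h h1 h2
  rw [show d ^ 2 = 2 - a ^ 2 by linarith] at this ⊢
  linear_combination -(a * (2 - a ^ 2) - x * (3 - a ^ 2)) * this

theorem ofReal_mem_nilpotentFour {x : ℝ} (hc : 0 < c) (hd : 0 < d) (hda : d ≤ a)
    (h : b ^ 2 + c ^ 2 = 1)
    (h1 : a ^ 2 + d ^ 2 = 2) (h2 : a ^ 2 * d ^ 2 = b ^ 2) (hx : 0 ≤ x) (hxd : 2 * x ≤ d) :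
    (x : ℂ) ∈ rankNumericalRange 2 (nilpotentFour b c) := by
  have ha : 0 < a := hd.trans_le hda
  have h1' : d ^ 2 + a ^ 2 = 2 := by linarith
  have h2' : d ^ 2 * a ^ 2 = b ^ 2 := by linarith
  have e₁ := Real.sq_sqrt (show 0 ≤ a - 2 * x by linarith)
  have e₂ := Real.sq_sqrt (show 0 ≤ d - 2 * x by linarith)
  have e₃ := Real.sq_sqrt (show 0 ≤ d + 2 * x by linarith)
  have e₄ := Real.sq_sqrt (show 0 ≤ a + 2 * x by linarith)
  have p₃ := Real.sqrt_pos.2 (show 0 < d + 2 * x by linarith)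
  have p₄ := Real.sqrt_pos.2 (show 0 < a + 2 * x by linarith)
  have ek := Real.sq_sqrt (show 0 ≤ 2 * c ^ 2 by positivity)
  have pk := Real.sqrt_pos.2 (show 0 < 2 * c ^ 2 by positivity)
  have key := balance_four hd hda e₁ e₂ e₃ e₄
  set h₁ := Real.sqrt (a - 2 * x)
  set h₂ := Real.sqrt (d - 2 * x)
  set h₃ := Real.sqrt (d + 2 * x)
  set h₄ := Real.sqrt (a + 2 * x)
  set k := Real.sqrt (2 * c ^ 2)
  have hself : ∀ u, eigenvectorFour b c u ≠ 0 := fun u h0 => hc.ne' (congrFun h0 0)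
  rw [nilpotentFour_eq_map]
  refine ofReal_mem_rankNumericalRange_two_of_diagonal _ x
    ![eigenvectorFour b c a, eigenvectorFour b c d, eigenvectorFour b c (-d),
      eigenvectorFour b c (-a)] (c ^ 2 * (d - a)) (c ^ 2 * (-d - a)) 0 0 (c ^ 2 * (-a - d))
    (c ^ 2 * (-a - -d)) (k * h₁) (k * h₂) (k * h₃) (k * h₄) (by positivity) (by positivity)
    ?_ ?_ ?_ ?_
  · have o1 : eigenvectorFour b c a ⬝ᵥ eigenvectorFour b c d = 0 :=
      eigenvectorFour_orthogonal h (by grind) (by grind)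
    have o2 : eigenvectorFour b c a ⬝ᵥ eigenvectorFour b c (-d) = 0 :=
      eigenvectorFour_orthogonal h (by grind) (by grind)
    have o3 : eigenvectorFour b c a ⬝ᵥ eigenvectorFour b c (-a) = 0 :=
      eigenvectorFour_orthogonal_neg ha.ne' h h1 h2
    have o4 : eigenvectorFour b c d ⬝ᵥ eigenvectorFour b c (-d) = 0 :=
      eigenvectorFour_orthogonal_neg hd.ne' h h1' h2'
    have o5 : eigenvectorFour b c d ⬝ᵥ eigenvectorFour b c (-a) = 0 :=
      eigenvectorFour_orthogonal h (by grind) (by grind)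
    have o6 : eigenvectorFour b c (-d) ⬝ᵥ eigenvectorFour b c (-a) = 0 :=
      eigenvectorFour_orthogonal h (by grind) (by grind)
    intro i j hij
    fin_cases i <;> fin_cases j <;> first | exact absurd hij (by decide) | assumption
  · intro i
    fin_cases i <;> exact hself _
  · have F : ∀ u v : ℝ, (u = a ∨ u = -a) → (v = d ∨ v = -d) →
        formFour b c x (eigenvectorFour b c u) (eigenvectorFour b c v) = c ^ 2 * (v - u) := by
      intro u v hu hv
      refine formFour_eigenvectorFour x h ?_ ?_ <;> grind
    have F' : ∀ u v : ℝ, (u = d ∨ u = -d) → (v = a ∨ v = -a) →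
        formFour b c x (eigenvectorFour b c u) (eigenvectorFour b c v) = c ^ 2 * (v - u) := by
      intro u v hu hv
      refine formFour_eigenvectorFour x h ?_ ?_ <;> grind
    have na : -a ≠ 0 := by linarith
    have nd : -d ≠ 0 := by linarith
    have G1 := formFour_eigenvectorFour_neg x ha.ne' h h1 h2
    have G2 := formFour_eigenvectorFour_neg x na (d := d) h (by rwa [neg_sq]) (by rwa [neg_sq])
    have G3 := formFour_eigenvectorFour_neg x hd.ne' h h1' h2'
    have G4 := formFour_eigenvectorFour_neg x nd (d := a) h (by rwa [neg_sq]) (by rwa [neg_sq])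
    rw [neg_neg] at G2 G4
    have S1 := formFour_eigenvectorFour_self x ha.ne' h h1 h2
    have S2 := formFour_eigenvectorFour_self x na (d := d) h (by rwa [neg_sq]) (by rwa [neg_sq])
    have S3 := formFour_eigenvectorFour_self x hd.ne' h h1' h2'
    have S4 := formFour_eigenvectorFour_self x nd (d := a) h (by rwa [neg_sq]) (by rwa [neg_sq])
    ext i j
    fin_cases i <;> fin_cases j
    · exact S1.trans (by simp; rw [mul_pow, ek, e₁])
    · exact F _ _ (.inl rfl) (.inl rfl)
    · exact F _ _ (.inl rfl) (.inr rfl)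
    · exact G1
    · exact (F' _ _ (.inl rfl) (.inl rfl)).trans (by simp; ring)
    · exact S3.trans (by simp; rw [mul_pow, ek, e₂])
    · exact G3
    · exact F' _ _ (.inl rfl) (.inr rfl)
    · exact (F' _ _ (.inr rfl) (.inl rfl)).trans (by simp; ring)
    · exact G4.trans (by simp)
    · exact S4.trans (by simp; rw [mul_pow, ek, e₃]; ring)
    · exact F' _ _ (.inr rfl) (.inr rfl)
    · exact G2.trans (by simp)
    · exact (F _ _ (.inr rfl) (.inl rfl)).trans (by simp; ring)
    · exact (F _ _ (.inr rfl) (.inr rfl)).trans (by simp; ring)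
    · exact S2.trans (by simp; rw [mul_pow, ek, e₄]; ring)
  · have := mul_le_mul_of_nonneg_left key (sq_nonneg (k ^ 2 * c ^ 2))
    linarith

end four

/-! ### Real points of the rank-two range in size five, for `s = 1`, `t = 0`, `c > 0`. -/

/-- There is slack: the bounds `(h₃ * h₄ - h₁ * h₂) ^ 2 ≤ 2 * d * h₄ ^ 2` and `a - d ≤ h₁ ^ 2`
eliminate `y` and leave `balance_five_aux`. -/
theorem balance_five {a d y h₁ h₂ h₃ h₄ : ℝ} (hd : 0 < d) (hd1 : d ≤ 1) (hda : d < a)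
    (hy : 0 ≤ y) (hyd : y ≤ d) (hh₁ : 0 ≤ h₁) (hh₂ : 0 ≤ h₂) (hh₃ : 0 ≤ h₃) (hh₄ : 0 ≤ h₄)
    (e₁ : h₁ ^ 2 = a - y) (e₂ : h₂ ^ 2 = d - y) (e₃ : h₃ ^ 2 = d + y) (e₄ : h₄ ^ 2 = a + y)
    (h1 : a ^ 2 + d ^ 2 = 3) (h2 : 1 ≤ a * d) :
    (1 - d ^ 2) * ((d - a) * (1 + 1 / (a * d)) * (h₃ * h₄ - h₁ * h₂)) ^ 2 ≤
      (a ^ 2 - 1) * (h₁ * h₄ / d) ^ 2 := by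
  have ha : 0 < a := hd.trans hda
  have hd2 : 0 ≤ 1 - d ^ 2 := by nlinarith
  have hs : (h₃ * h₄ - h₁ * h₂) ^ 2 ≤ 2 * d * h₄ ^ 2 := by
    have k1 : h₁ ≤ h₄ := (abs_le_of_sq_le_sq' (by rw [e₁, e₄]; linarith) hh₄).2
    have k2 : h₂ ≤ h₃ := (abs_le_of_sq_le_sq' (by rw [e₂, e₃]; linarith) hh₃).2
    have k3 : h₁ * h₂ ≤ h₃ * h₄ := by rw [mul_comm h₃]; gcongr
    calc (h₃ * h₄ - h₁ * h₂) ^ 2 ≤ (h₃ * h₄) ^ 2 :=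
          pow_le_pow_left₀ (by linarith) (by linarith [mul_nonneg hh₁ hh₂]) 2
      _ = h₃ ^ 2 * h₄ ^ 2 := by ring
      _ ≤ 2 * d * h₄ ^ 2 := by rw [e₃]; gcongr; linarith
  have aux := balance_five_aux ha hd hd1 h1 h2
  have aux' : (a - d) * (1 + 1 / (a * d)) ^ 2 * (1 - d ^ 2) * (2 * d) ≤ (a ^ 2 - 1) / d ^ 2 := by
    rw [← sub_nonneg] at aux ⊢
    have : (a ^ 2 - 1) / d ^ 2 - (a - d) * (1 + 1 / (a * d)) ^ 2 * (1 - d ^ 2) * (2 * d) =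
        (a ^ 2 * (a ^ 2 - 1) - 2 * (a - d) * (a * d + 1) ^ 2 * (1 - d ^ 2) * d) /
          (a * d) ^ 2 := by
      field_simp
    rw [this]
    positivity
  calc (1 - d ^ 2) * ((d - a) * (1 + 1 / (a * d)) * (h₃ * h₄ - h₁ * h₂)) ^ 2
      = (1 - d ^ 2) * (d - a) ^ 2 * (1 + 1 / (a * d)) ^ 2 * (h₃ * h₄ - h₁ * h₂) ^ 2 := by ring
    _ ≤ (1 - d ^ 2) * (d - a) ^ 2 * (1 + 1 / (a * d)) ^ 2 * (2 * d * h₄ ^ 2) := by gcongr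
    _ = (a - d) * (1 + 1 / (a * d)) ^ 2 * (1 - d ^ 2) * (2 * d) * ((a - d) * h₄ ^ 2) := by ring
    _ ≤ (a ^ 2 - 1) / d ^ 2 * ((a - d) * h₄ ^ 2) :=
        mul_le_mul_of_nonneg_right aux' (mul_nonneg (by linarith) (sq_nonneg _))
    _ ≤ (a ^ 2 - 1) / d ^ 2 * (h₁ ^ 2 * h₄ ^ 2) := by
        have : 0 ≤ a ^ 2 - 1 := by nlinarith
        rw [e₁]; gcongr
    _ = _ := by ring

section five

variable {a b c d : ℝ}

theorem sq_sub_one_mul_five (h : b ^ 2 + c ^ 2 = 1) (h1 : a ^ 2 + d ^ 2 = 3)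
    (h2 : a ^ 2 * d ^ 2 = 1 + b ^ 2) : (a ^ 2 - 1) * (d ^ 2 - 1) = -c ^ 2 := by
  linear_combination h2 - h1 + h

/-- The real bilinear form of `nilpotentFive b c 1 0 - x`. -/
noncomputable def formFive (b c x : ℝ) (v w : Fin 5 → ℝ) : ℝ :=
  v ⬝ᵥ
      (!![0, 0, 1, 0, 0; 0, 0, 0, b, 0 * c; 0, 0, 0, c, -(0 * b); 0, 0, 0, 0, 1;
    0, 0, 0, 0, 0] : Matrix (Fin 5) (Fin 5) ℝ) *ᵥ w - x * (v ⬝ᵥ w)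

theorem eigenvectorFive_orthogonal (h : b ^ 2 + c ^ 2 = 1)
    (h1 : a ^ 2 + d ^ 2 = 3) (h2 : a ^ 2 * d ^ 2 = 1 + b ^ 2) :
    eigenvectorFive b c a ⬝ᵥ eigenvectorFive b c d = 0 := by
  rw [eigenvectorFive_dotProduct, sq_sub_one_mul_five h h1 h2, add_comm (b ^ 2), ← h2]
  field_simp
  ring

theorem eigenvectorFive_orthogonal_neg (ha : a ≠ 0) (h : b ^ 2 + c ^ 2 = 1)
    (h1 : a ^ 2 + d ^ 2 = 3) (h2 : a ^ 2 * d ^ 2 = 1 + b ^ 2) :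
    eigenvectorFive b c a ⬝ᵥ eigenvectorFive b c (-a) = 0 := by
  rw [eigenvectorFive_dotProduct, add_comm (b ^ 2), ← h2, neg_sq]
  field_simp
  have := sq_sub_one_mul_five h h1 h2
  rw [show d ^ 2 = 3 - a ^ 2 by linarith] at this ⊢
  linear_combination (1 - a ^ 2) * this

theorem formFive_eigenvectorFive (x : ℝ) (ha : a ≠ 0) (hd : d ≠ 0) (h : b ^ 2 + c ^ 2 = 1)
    (h1 : a ^ 2 + d ^ 2 = 3) (h2 : a ^ 2 * d ^ 2 = 1 + b ^ 2) :
    formFive b c x (eigenvectorFive b c a) (eigenvectorFive b c d) =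
      c ^ 2 * ((d - a) * (1 + 1 / (a * d))) := by
  rw [formFive, eigenvectorFive_orthogonal h h1 h2, eigenvectorFive_form,
    sq_sub_one_mul_five h h1 h2, show b ^ 2 = a ^ 2 * d ^ 2 - 1 by linarith]
  field_simp
  ring

theorem formFive_eigenvectorFive_neg (x : ℝ) (ha : a ≠ 0) (h : b ^ 2 + c ^ 2 = 1)
    (h1 : a ^ 2 + d ^ 2 = 3) (h2 : a ^ 2 * d ^ 2 = 1 + b ^ 2) :
    formFive b c x (eigenvectorFive b c a) (eigenvectorFive b c (-a)) = -(c ^ 2 / a) := by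
  have := sq_sub_one_mul_five h h1 h2
  rw [show d ^ 2 = 3 - a ^ 2 by linarith] at this
  rw [formFive, eigenvectorFive_orthogonal_neg ha h h1 h2, eigenvectorFive_form, neg_sq,
    show b ^ 2 = 1 - c ^ 2 by linarith, show c ^ 2 = (a ^ 2 - 1) * (a ^ 2 - 2) by linarith]
  field_simp
  ring

theorem formFive_eigenvectorFive_self (x : ℝ) (ha : a ≠ 0) (h : b ^ 2 + c ^ 2 = 1)
    (h1 : a ^ 2 + d ^ 2 = 3) (h2 : a ^ 2 * d ^ 2 = 1 + b ^ 2) :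
    formFive b c x (eigenvectorFive b c a) (eigenvectorFive b c a) =
      (a ^ 2 - 1) * (a ^ 2 - d ^ 2) * (a - 2 * x) := by
  have := sq_sub_one_mul_five h h1 h2
  rw [show d ^ 2 = 3 - a ^ 2 by linarith] at this ⊢
  rw [formFive, eigenvectorFive_form, eigenvectorFive_dotProduct,
    show b ^ 2 = 1 - c ^ 2 by linarith, show c ^ 2 = (a ^ 2 - 1) * (a ^ 2 - 2) by linarith]
  field_simp
  ring

set_option maxHeartbeats 1000000 in
theorem ofReal_mem_nilpotentFive {x : ℝ} (hc : 0 < c) (hd : 0 < d) (hda : d ≤ a)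
    (h : b ^ 2 + c ^ 2 = 1)
    (h1 : a ^ 2 + d ^ 2 = 3) (h2 : a ^ 2 * d ^ 2 = 1 + b ^ 2) (hx : 0 ≤ x) (hxd : 2 * x ≤ d) :
    (x : ℂ) ∈ rankNumericalRange 2 (nilpotentFive b c 1 0) := by
  have hm := sq_sub_one_mul_five h h1 h2
  have hc2 : 0 < c ^ 2 := by positivity
  have had2 : d ^ 2 ≤ a ^ 2 := by gcongr
  -- `(a ^ 2 - 1) * (d ^ 2 - 1)` is negative, so `1` separates `d ^ 2` from `a ^ 2`. Hence the norms
  -- at `±a` and `±d` need the separate scales `l` and `k`.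
  have hd1 : d ^ 2 < 1 := by nlinarith
  have ha1 : 1 < a ^ 2 := by nlinarith
  have hΔ : 0 < a ^ 2 - d ^ 2 := by linarith
  have hda : d < a := lt_of_le_of_ne hda fun h => by rw [h] at hd1; linarith
  have ha : 0 < a := hd.trans hda
  have hπ : 1 ≤ a * d := by
    refine (abs_le_of_sq_le_sq' ?_ (by positivity)).2
    rw [mul_pow, h2]; nlinarith
  have h1' : d ^ 2 + a ^ 2 = 3 := by linarith
  have h2' : d ^ 2 * a ^ 2 = 1 + b ^ 2 := by linarith
  have e₁ := Real.sq_sqrt (show 0 ≤ a - 2 * x by linarith)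
  have e₂ := Real.sq_sqrt (show 0 ≤ d - 2 * x by linarith)
  have e₃ := Real.sq_sqrt (show 0 ≤ d + 2 * x by linarith)
  have e₄ := Real.sq_sqrt (show 0 ≤ a + 2 * x by linarith)
  have p₁ := Real.sqrt_nonneg (a - 2 * x)
  have p₂ := Real.sqrt_nonneg (d - 2 * x)
  have p₃ := Real.sqrt_pos.2 (show 0 < d + 2 * x by linarith)
  have p₄ := Real.sqrt_pos.2 (show 0 < a + 2 * x by linarith)
  have el := Real.sq_sqrt (mul_nonneg (by linarith : 0 ≤ a ^ 2 - 1) hΔ.le)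
  have pl := Real.sqrt_pos.2 (mul_pos (by linarith : 0 < a ^ 2 - 1) hΔ)
  have ek := Real.sq_sqrt (mul_nonneg (by linarith : 0 ≤ 1 - d ^ 2) hΔ.le)
  have pk := Real.sqrt_pos.2 (mul_pos (by linarith : 0 < 1 - d ^ 2) hΔ)
  have key := balance_five hd ((sq_lt_one_iff₀ hd.le).1 hd1).le hda (by linarith : 0 ≤ 2 * x) hxd p₁ p₂
    p₃.le p₄.le e₁ e₂ e₃ e₄ h1 hπ
  set h₁ := Real.sqrt (a - 2 * x)
  set h₂ := Real.sqrt (d - 2 * x)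
  set h₃ := Real.sqrt (d + 2 * x)
  set h₄ := Real.sqrt (a + 2 * x)
  set l := Real.sqrt ((a ^ 2 - 1) * (a ^ 2 - d ^ 2))
  set k := Real.sqrt ((1 - d ^ 2) * (a ^ 2 - d ^ 2))
  have hself : ∀ u, eigenvectorFive b c u ≠ 0 := fun u h0 => hc.ne' (congrFun h0 0)
  rw [nilpotentFive_eq_map]
  refine ofReal_mem_rankNumericalRange_two_of_diagonal _ x
    ![eigenvectorFive b c a, eigenvectorFive b c d, eigenvectorFive b c (-d),
      eigenvectorFive b c (-a)] (c ^ 2 * ((d - a) * (1 + 1 / (a * d))))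
    (c ^ 2 * ((-d - a) * (1 + 1 / (a * -d)))) (-(c ^ 2 / a)) (-(c ^ 2 / d))
    (c ^ 2 * ((-a - d) * (1 + 1 / (d * -a))))
    (c ^ 2 * ((-a - -d) * (1 + 1 / (-d * -a)))) (l * h₁) (k * h₂) (k * h₃) (l * h₄)
    (by positivity) (by positivity) ?_ ?_ ?_ ?_
  · have o1 : eigenvectorFive b c a ⬝ᵥ eigenvectorFive b c d = 0 :=
      eigenvectorFive_orthogonal h (by grind) (by grind)
    have o2 : eigenvectorFive b c a ⬝ᵥ eigenvectorFive b c (-d) = 0 :=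
      eigenvectorFive_orthogonal h (by grind) (by grind)
    have o3 : eigenvectorFive b c a ⬝ᵥ eigenvectorFive b c (-a) = 0 :=
      eigenvectorFive_orthogonal_neg ha.ne' h h1 h2
    have o4 : eigenvectorFive b c d ⬝ᵥ eigenvectorFive b c (-d) = 0 :=
      eigenvectorFive_orthogonal_neg hd.ne' h h1' h2'
    have o5 : eigenvectorFive b c d ⬝ᵥ eigenvectorFive b c (-a) = 0 :=
      eigenvectorFive_orthogonal h (by grind) (by grind)
    have o6 : eigenvectorFive b c (-d) ⬝ᵥ eigenvectorFive b c (-a) = 0 :=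
      eigenvectorFive_orthogonal h (by grind) (by grind)
    intro i j hij
    fin_cases i <;> fin_cases j <;> first | exact absurd hij (by decide) | assumption
  · intro i
    fin_cases i <;> exact hself _
  · have F : ∀ u v : ℝ, (u = a ∨ u = -a) → (v = d ∨ v = -d) →
        formFive b c x (eigenvectorFive b c u) (eigenvectorFive b c v) =
          c ^ 2 * ((v - u) * (1 + 1 / (u * v))) := by
      intro u v hu hv
      refine formFive_eigenvectorFive x ?_ ?_ h ?_ ?_ <;> grind
    have F' : ∀ u v : ℝ, (u = d ∨ u = -d) → (v = a ∨ v = -a) →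
        formFive b c x (eigenvectorFive b c u) (eigenvectorFive b c v) =
          c ^ 2 * ((v - u) * (1 + 1 / (u * v))) := by
      intro u v hu hv
      refine formFive_eigenvectorFive x ?_ ?_ h ?_ ?_ <;> grind
    have na : -a ≠ 0 := by linarith
    have nd : -d ≠ 0 := by linarith
    have G1 := formFive_eigenvectorFive_neg x ha.ne' h h1 h2
    have G2 := formFive_eigenvectorFive_neg x na (d := d) h (by rwa [neg_sq]) (by rwa [neg_sq])
    have G3 := formFive_eigenvectorFive_neg x hd.ne' h h1' h2'
    have G4 := formFive_eigenvectorFive_neg x nd (d := a) h (by rwa [neg_sq]) (by rwa [neg_sq])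
    rw [neg_neg, div_neg, neg_neg] at G2 G4
    have S1 := formFive_eigenvectorFive_self x ha.ne' h h1 h2
    have S2 := formFive_eigenvectorFive_self x na (d := d) h (by rwa [neg_sq]) (by rwa [neg_sq])
    have S3 := formFive_eigenvectorFive_self x hd.ne' h h1' h2'
    have S4 := formFive_eigenvectorFive_self x nd (d := a) h (by rwa [neg_sq]) (by rwa [neg_sq])
    ext i j
    fin_cases i <;> fin_cases j
    · exact S1.trans (by simp; rw [mul_pow, el, e₁])
    · exact F _ _ (.inl rfl) (.inl rfl)
    · exact F _ _ (.inl rfl) (.inr rfl)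
    · exact G1
    · exact (F' _ _ (.inl rfl) (.inl rfl)).trans (by simp; ring)
    · exact S3.trans (by simp; rw [mul_pow, ek, e₂]; ring)
    · exact G3
    · exact F' _ _ (.inl rfl) (.inr rfl)
    · exact (F' _ _ (.inr rfl) (.inl rfl)).trans (by simp; ring)
    · exact G4.trans (by simp)
    · exact S4.trans (by simp; rw [mul_pow, ek, e₃]; ring)
    · exact F' _ _ (.inr rfl) (.inr rfl)
    · exact G2.trans (by simp)
    · exact (F _ _ (.inr rfl) (.inl rfl)).trans (by simp; ring)
    · exact (F _ _ (.inr rfl) (.inr rfl)).trans (by simp; ring)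
    · exact S2.trans (by simp; rw [mul_pow, el, e₄]; ring)
  -- The second square suffices, and within it the summand with `c ^ 2 / d`.
  · refine le_trans ?_ (le_add_of_nonneg_left (sq_nonneg _))
    have hs : (k * h₃ * (l * h₄) * (c ^ 2 * ((d - a) * (1 + 1 / (a * d)))) -
        l * h₁ * (k * h₂) * (c ^ 2 * ((-a - -d) * (1 + 1 / (-d * -a))))) ^ 2 =
        c ^ 4 * l ^ 2 * (a ^ 2 - d ^ 2) *
          ((1 - d ^ 2) * ((d - a) * (1 + 1 / (a * d)) * (h₃ * h₄ - h₁ * h₂)) ^ 2) := by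
      rw [neg_mul_neg, mul_comm d a]
      linear_combination (c ^ 4 * l ^ 2 *
        ((d - a) * (1 + 1 / (a * d)) * (h₃ * h₄ - h₁ * h₂)) ^ 2) * ek
    rw [hs]
    calc _ ≤ c ^ 4 * l ^ 2 * (a ^ 2 - d ^ 2) * ((a ^ 2 - 1) * (h₁ * h₄ / d) ^ 2) :=
          mul_le_mul_of_nonneg_left key (by positivity)
      _ = (l * h₁ * (l * h₄) * (c ^ 2 / d)) ^ 2 := by
          linear_combination (-c ^ 4 * l ^ 2 * (h₁ * h₄ / d) ^ 2) * el
      _ ≤ (k * h₂ * (k * h₃) * (c ^ 2 / a) + l * h₁ * (l * h₄) * (c ^ 2 / d)) ^ 2 := by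
          gcongr
          exact le_add_of_nonneg_left (by positivity)
      _ = _ := by ring

end five

/-! ### Degenerate parameters, the adjoint symmetry and the gradings. -/

theorem zero_mem_rankNumericalRange_of_submatrix_eq_zero {n k : ℕ}
    {M : Matrix (Fin n) (Fin n) ℂ} (f : Fin k → Fin n) (hf : Function.Injective f)
    (h : M.submatrix f f = 0) : (0 : ℂ) ∈ rankNumericalRange k M := by
  let V : Matrix (Fin n) (Fin k) ℂ := (1 : Matrix (Fin n) (Fin n) ℂ).submatrix id f
  have hVt : Vᴴ = (1 : Matrix (Fin n) (Fin n) ℂ).submatrix f id := by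
    rw [conjTranspose_submatrix, conjTranspose_one]
  have hmul : ∀ B : Matrix (Fin n) (Fin n) ℂ, Vᴴ * B * V = B.submatrix f f := fun B => by
    rw [hVt]
    ext i j
    simp [V, Matrix.mul_apply, Matrix.one_apply]
  refine mem_rankNumericalRange_of_gram V ?_ ?_
  · have := hmul 1
    rw [Matrix.mul_one, submatrix_one f hf] at this
    simp [this]
  · rw [hmul, h, zero_smul]

theorem exists_mul_eq_mul_sq_add_sq {x : ℝ} (hx : 0 ≤ x) (hx2 : 2 * x ≤ 1) :
    ∃ α β : ℝ, α ≠ 0 ∧ α * β = x * (α ^ 2 + β ^ 2) := by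
  have hs := Real.sq_sqrt (show 0 ≤ 1 - 4 * x ^ 2 by nlinarith)
  have hp := Real.sqrt_nonneg (1 - 4 * x ^ 2)
  -- The ratio `β / α` is the smaller root of `x * τ ^ 2 - τ + x`, written so that `x = 0` is
  -- allowed.
  refine ⟨1 + Real.sqrt (1 - 4 * x ^ 2), 2 * x, by positivity, ?_⟩
  linear_combination -x * hs

theorem ofReal_mem_nilpotentFour_one_zero {x : ℝ} (hx : 0 ≤ x) (hx2 : 2 * x ≤ 1) :
    (x : ℂ) ∈ rankNumericalRange 2 (nilpotentFour 1 0) := by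
  obtain ⟨α, β, hα, h⟩ := exists_mul_eq_mul_sq_add_sq hx hx2
  have h0 : 0 < α * α + β * β :=
    add_pos_of_pos_of_nonneg (mul_self_pos.2 hα) (mul_self_nonneg β)
  rw [nilpotentFour_eq_map]
  refine ofReal_mem_rankNumericalRange_two _ x ![α, 0, β, 0] ![0, α, 0, β] ?_ ?_ ?_ ?_ ?_
  · simp [dotProduct, Fin.sum_univ_succ]
    exact h0.ne'
  all_goals simp [dotProduct, mulVec, Fin.sum_univ_succ]
  all_goals linear_combination h

theorem ofReal_mem_nilpotentFive_of_mul_eq_zero {b c s t x : ℝ} (ht : 0 ≤ t)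
    (hbc : b ^ 2 + c ^ 2 = 1) (hst : s ^ 2 + t ^ 2 = 1) (hcs : c * s = 0)
    (hx : 0 ≤ x) (hx2 : 2 * x ≤ 1) :
    (x : ℂ) ∈ rankNumericalRange 2 (nilpotentFive b c s t) := by
  obtain ⟨α, β, hα, h⟩ := exists_mul_eq_mul_sq_add_sq hx hx2
  have h0 : 0 < α * α + β * β :=
    add_pos_of_pos_of_nonneg (mul_self_pos.2 hα) (mul_self_nonneg β)
  have hct : c * t = c := by
    rcases mul_eq_zero.1 hcs with rfl | rfl
    · simp
    · rw [show t = 1 by nlinarith, mul_one]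
  have hn : β * b * (β * b) + β * c * (β * c) = β * β := by linear_combination β ^ 2 * hbc
  rw [nilpotentFive_eq_map]
  refine ofReal_mem_rankNumericalRange_two _ x ![α, 0, β, 0, 0] ![0, α, 0, β * b, β * c]
    ?_ ?_ ?_ ?_ ?_
  · simp [dotProduct, Fin.sum_univ_succ, hn]
    exact h0.ne'
  all_goals simp [dotProduct, mulVec, Fin.sum_univ_succ, hn]
  · linear_combination h
  · linear_combination h + α * β * hbc + α * β * c * hct + β ^ 2 * b * hcs
  · right
    linear_combination -β * b * hct

/-- For `b = 0` the matrix `nilpotentFive b c s t` is, up to unitary similarity, the adjoint of one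
with `t = 0`. -/
theorem unitarilySimilar_conjTranspose_nilpotentFive {s t : ℝ} (hst : s ^ 2 + t ^ 2 = 1) :
    UnitarilySimilar (nilpotentFive t s 1 0) (nilpotentFive 0 1 s t)ᴴ := by
  have hst' : (s : ℂ) * s + t * t = 1 := by exact_mod_cast (by linarith : s * s + t * t = 1)
  have hst2 : (t : ℂ) * t + s * s = 1 := by rw [add_comm, hst']
  -- Taking adjoints reverses the grading. `Q` matches the degrees, with a reflection in the
  -- two-dimensional degree-one piece.
  let Q : Matrix (Fin 5) (Fin 5) ℂ :=
    !![0, 0, 0, 0, 1;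
       0, -(s : ℂ), (t : ℂ), 0, 0;
       0, 0, 0, 1, 0;
       0, (t : ℂ), (s : ℂ), 0, 0;
       1, 0, 0, 0, 0]
  have hQ : star Q * Q = 1 := by
    ext i j
    fin_cases i <;> fin_cases j <;>
      simp [Q, Matrix.mul_apply, Fin.sum_univ_succ, star_apply, hst', hst2, mul_comm]
  refine ⟨Q, (mem_unitaryGroup_iff').2 hQ, ?_⟩
  have : Q * nilpotentFive t s 1 0 = (nilpotentFive 0 1 s t)ᴴ * Q := by
    ext i j
    fin_cases i <;> fin_cases j <;>
      simp [Q, nilpotentFive, Matrix.mul_apply, Fin.sum_univ_succ, conjTranspose_apply, mul_comm]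
    all_goals first | linear_combination hst' | linear_combination -hst'
  rw [mul_assoc, ← this, ← mul_assoc, hQ, one_mul]

theorem isGradedBy_nilpotentFour (b c : ℝ) : IsGradedBy (nilpotentFour b c) ![0, 1, 1, 2] := by
  intro i j
  fin_cases i <;> fin_cases j <;> simp [nilpotentFour]

/-- The obstruction is that index `1` reaches index `4` both directly, by `t * c`, and in two steps,
by `b` and `s`. A vanishing factor breaks the conflict. -/
theorem exists_isGradedBy_nilpotentFive {b c s t : ℝ} (h : b * c * s * t = 0) :
    ∃ d, IsGradedBy (nilpotentFive b c s t) d := by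
  rcases mul_eq_zero.1 h with h | rfl
  rcases mul_eq_zero.1 h with h | rfl
  rcases mul_eq_zero.1 h with rfl | rfl
  · refine ⟨![0, 2, 1, 2, 3], fun i j => ?_⟩
    fin_cases i <;> fin_cases j <;> simp [nilpotentFive]
  · refine ⟨![0, 0, 1, 1, 2], fun i j => ?_⟩
    fin_cases i <;> fin_cases j <;> simp [nilpotentFive]
  · refine ⟨![0, 1, 1, 2, 2], fun i j => ?_⟩
    fin_cases i <;> fin_cases j <;> simp [nilpotentFive]
  · refine ⟨![0, 1, 1, 2, 3], fun i j => ?_⟩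
    fin_cases i <;> fin_cases j <;> simp [nilpotentFive]

theorem zero_mem_rankNumericalRange_nilpotentFive {b c s t : ℝ} (h : b * c * s * t = 0) :
    (0 : ℂ) ∈ rankNumericalRange 3 (nilpotentFive b c s t) := by
  rcases mul_eq_zero.1 h with h | rfl
  rcases mul_eq_zero.1 h with h | rfl
  rcases mul_eq_zero.1 h with rfl | rfl
  · refine zero_mem_rankNumericalRange_of_submatrix_eq_zero ![0, 1, 3] (by decide) ?_
    ext i j
    fin_cases i <;> fin_cases j <;> simp [nilpotentFive]
  · refine zero_mem_rankNumericalRange_of_submatrix_eq_zero ![0, 1, 4] (by decide) ?_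
    ext i j
    fin_cases i <;> fin_cases j <;> simp [nilpotentFive]
  · refine zero_mem_rankNumericalRange_of_submatrix_eq_zero ![0, 3, 4] (by decide) ?_
    ext i j
    fin_cases i <;> fin_cases j <;> simp [nilpotentFive]
  · refine zero_mem_rankNumericalRange_of_submatrix_eq_zero ![0, 1, 4] (by decide) ?_
    ext i j
    fin_cases i <;> fin_cases j <;> simp [nilpotentFive]

/-! ### The radii as half-eigenvalues, and the final assembly. -/

theorem exists_sq_add_sq_eq_two {b : ℝ} (hb : b ^ 2 ≤ 1) :
    ∃ a : ℝ, 2 * Real.sqrt (1 / 4 - Real.sqrt (1 / 16 - b ^ 2 / 16)) ≤ a ∧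
      a ^ 2 + (2 * Real.sqrt (1 / 4 - Real.sqrt (1 / 16 - b ^ 2 / 16))) ^ 2 = 2 ∧
      a ^ 2 * (2 * Real.sqrt (1 / 4 - Real.sqrt (1 / 16 - b ^ 2 / 16))) ^ 2 = b ^ 2 := by
  have hq := Real.sq_sqrt (show 0 ≤ 1 / 16 - b ^ 2 / 16 by linarith)
  have hq0 := Real.sqrt_nonneg (1 / 16 - b ^ 2 / 16)
  set q := Real.sqrt (1 / 16 - b ^ 2 / 16)
  have hq4 : q ≤ 1 / 4 := by nlinarith [sq_nonneg b]
  have e1 := Real.sq_sqrt (sub_nonneg.2 hq4)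
  have e2 := Real.sq_sqrt (show 0 ≤ 1 / 4 + q by linarith)
  refine ⟨2 * Real.sqrt (1 / 4 + q), ?_, ?_, ?_⟩
  · gcongr; linarith
  · rw [mul_pow, mul_pow, e1, e2]; ring
  · rw [mul_pow, mul_pow, e1, e2]; linear_combination -16 * hq

theorem exists_sq_add_sq_eq_three {e : ℝ} (he0 : 0 ≤ e) (he : e ≤ 1) :
    ∃ a d : ℝ, 1 / 2 * Real.sqrt ((3 - Real.sqrt (5 - 4 * e)) / 2) = d / 2 ∧ 0 < d ∧ d ≤ a ∧
      a ^ 2 + d ^ 2 = 3 ∧ a ^ 2 * d ^ 2 = 1 + e := by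
  have hq := Real.sq_sqrt (show 0 ≤ 5 - 4 * e by linarith)
  have hq0 := Real.sqrt_nonneg (5 - 4 * e)
  set q := Real.sqrt (5 - 4 * e)
  have hq3 : q < 3 := by nlinarith
  have e1 := Real.sq_sqrt (show 0 ≤ (3 - q) / 2 by linarith)
  have e2 := Real.sq_sqrt (show 0 ≤ (3 + q) / 2 by linarith)
  refine ⟨Real.sqrt ((3 + q) / 2), Real.sqrt ((3 - q) / 2), by ring,
    Real.sqrt_pos.2 (by linarith), ?_, ?_, ?_⟩
  · gcongr; linarith
  · rw [e1, e2]; ring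
  · rw [e1, e2]; linear_combination -hq / 4

theorem rankNumericalRange_two_nilpotentFour {b c : ℝ} (hb : 0 ≤ b) (hc : 0 ≤ c)
    (h : b ^ 2 + c ^ 2 = 1) : rankNumericalRange 2 (nilpotentFour b c) =
      Metric.closedBall (0 : ℂ) (Real.sqrt (1 / 4 - Real.sqrt (1 / 16 - b ^ 2 / 16))) := by
  obtain ⟨a, hda, h1, h2⟩ := exists_sq_add_sq_eq_two (b := b) (by nlinarith)
  have hr := Real.sqrt_nonneg (1 / 4 - Real.sqrt (1 / 16 - b ^ 2 / 16))
  set r := Real.sqrt (1 / 4 - Real.sqrt (1 / 16 - b ^ 2 / 16))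
  refine (isGradedBy_nilpotentFour b c).rankNumericalRange_eq_closedBall (fun x hx => ?_)
    fun x hx hxr => ?_
  · refine le_of_mul_le_mul_left (nilpotentFour_two_mul_le h h1 h2 ?_ hx) two_pos
    simp only [Multiset.insert_eq_cons, ← Multiset.cons_zero,
      Multiset.countP_cons, Multiset.countP_zero]
    split_ifs <;> first | omega | linarith
  · rcases hc.eq_or_lt with rfl | hc
    · obtain rfl : b = 1 := by nlinarith
      refine ofReal_mem_nilpotentFour_one_zero hx ?_
      nlinarith
    rcases hr.eq_or_lt with hr0 | hr0
    · obtain rfl : x = 0 := le_antisymm (hr0 ▸ hxr) hx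
      obtain rfl : b = 0 := by
        rw [← hr0] at h2
        exact pow_eq_zero_iff two_ne_zero |>.1 (by linarith)
      refine zero_mem_rankNumericalRange_of_submatrix_eq_zero ![0, 1] (by decide) ?_
      ext i j
      fin_cases i <;> fin_cases j <;> simp [nilpotentFour]
    · exact ofReal_mem_nilpotentFour hc (by linarith) hda h h1 h2 hx (by linarith)

theorem rankNumericalRange_three_nilpotentFour {b c : ℝ} (hb : b ≠ 0)
    (h : b ^ 2 + c ^ 2 = 1) : rankNumericalRange 3 (nilpotentFour b c) = ∅ := by
  obtain ⟨a, hda, h1, h2⟩ := exists_sq_add_sq_eq_two (b := b) (by nlinarith)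
  have hr := Real.sqrt_nonneg (1 / 4 - Real.sqrt (1 / 16 - b ^ 2 / 16))
  set r := Real.sqrt (1 / 4 - Real.sqrt (1 / 16 - b ^ 2 / 16))
  have hr0 : 0 < r := by
    refine lt_of_le_of_ne hr fun h0 => hb ?_
    rw [← h0] at h2
    exact pow_eq_zero_iff two_ne_zero |>.1 (by linarith)
  refine (isGradedBy_nilpotentFour b c).rankNumericalRange_eq_empty fun x hx => ?_
  -- Only `a` and `2 * r` lie strictly above `-(2 * r)`, which is fewer than three eigenvalues.
  have := nilpotentFour_two_mul_le (r := -(2 * r)) h h1 h2 (by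
    simp only [Multiset.insert_eq_cons, ← Multiset.cons_zero,
      Multiset.countP_cons, Multiset.countP_zero]
    split_ifs <;> first | omega | linarith) hx
  linarith

section five

variable {b c s t : ℝ}

theorem rankNumericalRange_two_nilpotentFive (hb : 0 ≤ b) (hc : 0 ≤ c) (hs : 0 ≤ s) (ht : 0 ≤ t)
    (hst : s ^ 2 + t ^ 2 = 1) (hbc : b ^ 2 + c ^ 2 = 1) (h0 : b * c * s * t = 0) :
    rankNumericalRange 2 (nilpotentFive b c s t) = Metric.closedBall (0 : ℂ)
      (1 / 2 * Real.sqrt ((3 - Real.sqrt (5 - 4 * (b ^ 2 + c ^ 2 * t ^ 2))) / 2)) := by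
  obtain ⟨a, d, hr, hd, hda, h1, h2⟩ := exists_sq_add_sq_eq_three (e := b ^ 2 + c ^ 2 * t ^ 2)
    (by positivity) (by nlinarith [mul_nonneg (sq_nonneg c) (sq_nonneg s)])
  obtain ⟨f, hf⟩ := exists_isGradedBy_nilpotentFive h0
  rw [hr]
  refine hf.rankNumericalRange_eq_closedBall (fun x hx => ?_) fun x hx hxr => ?_
  · have := nilpotentFive_two_mul_le (r := d) hbc hst h0 h1 (h2.trans (add_assoc _ _ _).symm) (by
      simp only [Multiset.insert_eq_cons, ← Multiset.cons_zero,
      Multiset.countP_cons, Multiset.countP_zero]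
      split_ifs <;> first | omega | linarith) hx
    linarith
  -- If `c * s = 0` then `d = 1` and explicit vectors reach radius `1 / 2`. Otherwise `t = 0`, which
  -- is the eigenvector case, or `b = 0`, which is its adjoint.
  · by_cases hcs : c * s = 0
    · refine ofReal_mem_nilpotentFive_of_mul_eq_zero ht hbc hst hcs hx ?_
      have he : b ^ 2 + c ^ 2 * t ^ 2 = 1 := by linear_combination hbc + c ^ 2 * hst - c * s * hcs
      rw [he] at h2
      have : d ^ 2 ≤ a ^ 2 := by gcongr
      have hd1 : d ^ 2 = 1 := by nlinarith
      nlinarith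
    · have hc' : c ≠ 0 := left_ne_zero_of_mul hcs
      have hs' : s ≠ 0 := right_ne_zero_of_mul hcs
      rcases eq_or_ne t 0 with rfl | ht'
      · obtain rfl : s = 1 := by nlinarith
        exact ofReal_mem_nilpotentFive (hc.lt_of_ne' hc') hd hda hbc h1
          (by rw [h2]; ring) hx (by linarith)
      · obtain rfl : b = 0 := by simpa [hc', hs', ht'] using h0
        obtain rfl : c = 1 := by nlinarith
        have := ofReal_mem_nilpotentFive (x := x) (hs.lt_of_ne' hs') hd hda
          (by linarith : t ^ 2 + s ^ 2 = 1) h1 (by rw [h2]; ring) hx (by linarith)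
        rw [(unitarilySimilar_conjTranspose_nilpotentFive hst).rankNumericalRange_eq] at this
        simpa using star_mem_rankNumericalRange_conjTranspose this

theorem rankNumericalRange_three_nilpotentFive
    (hst : s ^ 2 + t ^ 2 = 1) (hbc : b ^ 2 + c ^ 2 = 1) (h0 : b * c * s * t = 0) :
    rankNumericalRange 3 (nilpotentFive b c s t) = {0} := by
  obtain ⟨a, d, -, hd, hda, h1, h2⟩ := exists_sq_add_sq_eq_three (e := b ^ 2 + c ^ 2 * t ^ 2)
    (by positivity) (by nlinarith [mul_nonneg (sq_nonneg c) (sq_nonneg s)])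
  obtain ⟨f, hf⟩ := exists_isGradedBy_nilpotentFive h0
  rw [← Metric.closedBall_zero]
  refine hf.rankNumericalRange_eq_closedBall (fun x hx => ?_) fun x hx hxr => ?_
  · have := nilpotentFive_two_mul_le (r := 0) hbc hst h0 h1 (h2.trans (add_assoc _ _ _).symm) (by
      simp only [Multiset.insert_eq_cons, ← Multiset.cons_zero,
      Multiset.countP_cons, Multiset.countP_zero]
      split_ifs <;> first | omega | linarith) hx
    linarith
  · obtain rfl : x = 0 := le_antisymm hxr hx
    exact zero_mem_rankNumericalRange_nilpotentFive h0

theorem rankNumericalRange_four_nilpotentFive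
    (hst : s ^ 2 + t ^ 2 = 1) (hbc : b ^ 2 + c ^ 2 = 1) (h0 : b * c * s * t = 0) :
    rankNumericalRange 4 (nilpotentFive b c s t) = ∅ := by
  obtain ⟨a, d, -, hd, hda, h1, h2⟩ := exists_sq_add_sq_eq_three (e := b ^ 2 + c ^ 2 * t ^ 2)
    (by positivity) (by nlinarith [mul_nonneg (sq_nonneg c) (sq_nonneg s)])
  obtain ⟨f, hf⟩ := exists_isGradedBy_nilpotentFive h0
  refine hf.rankNumericalRange_eq_empty fun x hx => ?_
  have := nilpotentFive_two_mul_le (r := -d) hbc hst h0 h1 (h2.trans (add_assoc _ _ _).symm) (by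
    simp only [Multiset.insert_eq_cons, ← Multiset.cons_zero,
      Multiset.countP_cons, Multiset.countP_zero]
    split_ifs <;> first | omega | linarith) hx
  linarith

end five

theorem mainTheorem8 :
    (∀ (b c : ℝ), 0 ≤ b → 0 ≤ c → b ^ 2 + c ^ 2 = 1 →
      ∀ A : Matrix (Fin 4) (Fin 4) ℂ, UnitarilySimilar A (nilpotentFour b c) →
        rankNumericalRange 2 A =
          Metric.closedBall (0 : ℂ) (Real.sqrt (1 / 4 - Real.sqrt (1 / 16 - b ^ 2 / 16))) ∧
        (b ≠ 0 → rankNumericalRange 3 A = ∅)) ∧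
    (∀ (b c s t : ℝ), 0 ≤ b → 0 ≤ c → 0 ≤ s → 0 ≤ t →
      s ^ 2 + t ^ 2 = 1 → b ^ 2 + c ^ 2 = 1 → b * c * s * t = 0 →
      ∀ A : Matrix (Fin 5) (Fin 5) ℂ, UnitarilySimilar A (nilpotentFive b c s t) →
        rankNumericalRange 2 A =
          Metric.closedBall (0 : ℂ)
            (1 / 2 * Real.sqrt ((3 - Real.sqrt (5 - 4 * (b ^ 2 + c ^ 2 * t ^ 2))) / 2)) ∧
        rankNumericalRange 3 A = {0} ∧
        rankNumericalRange 4 A = ∅) := by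
  refine ⟨fun b c hb hc h A hA => ?_, fun b c s t hb hc hs ht hst hbc h0 A hA => ?_⟩
  · rw [hA.rankNumericalRange_eq, hA.rankNumericalRange_eq]
    exact ⟨rankNumericalRange_two_nilpotentFour hb hc h,
      fun hb => rankNumericalRange_three_nilpotentFour hb h⟩
  · rw [hA.rankNumericalRange_eq, hA.rankNumericalRange_eq, hA.rankNumericalRange_eq]
    exact ⟨rankNumericalRange_two_nilpotentFive hb hc hs ht hst hbc h0,
      rankNumericalRange_three_nilpotentFive hst hbc h0,
      rankNumericalRange_four_nilpotentFive hst hbc h0⟩
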